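/- Let $\nu\ge 1$, write $k=(k_1,\dots,k_\nu)=(y,z)$ with $y=k_1$, $z=(k_2,\dots,k_\nu)$, and for a function $f$ smooth ($C^\infty$) near $0\in\mathbb R^\nu$ put $f_{y^az^b}=\frac{\partial^{a+b}f(0)}{\partial y^a\partial z^b}$ (a number, a vector, a matrix, a three-index array for $b=0,1,2,3$). Let $f_{z^2}^{-1}$ be the inverse of the matrix $\big\|\frac{\partial^2 f(0)}{\partial k_i\partial k_j}\big\|_{i,j=2,\dots,\nu}$. A germ $f$ at $0$ has type $A_m^\pm$ if $f\circ h^{-1}=c\pm k_1^{m+1}+Q(k_2,\dots,k_\nu)$ near $0$ for a constant $c$, a nondegenerate quadratic form $Q$ in $\nu-1$ variables and a germ of a smooth diffeomorphism $h$ with $h(0)=0$. An even germ $f$ has the even type $A_{e,\mu}^\pm$ if $f\circ h^{-1}=c\pm k_1^{2\mu}+Q(k_2,\dots,k_\nu)$ near $0$ for such $c$, $Q$ and a germ of a smooth diffeomorphism $h$ with $h(0)=0$ which is odd, $h(-k)=-h(k)$. Type $A_m$ (type $A_{e,\mu}$) means $A_m^+$ or $A_m^-$ ($A_{e,\mu}^+$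 or $A_{e,\mu}^-$). Then there exist polynomials $P_m$ ($m\ge2$) with integer coefficients and vanishing free term, depending only on $\nu$ and $m$, in the partial derivatives of $f$ at $0$ of orders $3,\dots,m$ (except the derivatives with respect to $k_1$ only) and in the components of $f_{z^2}^{-1}$, such that the numbers $$a_m=a_m(f)=\frac{\partial^{m+1}f(0)}{\partial k_1^{m+1}}+P_m\qquad(m\ge2)$$ have the following properties. (0) Let $f$ be any smooth function near $0$ (not necessarily even) such that $0$ is a critical point and the kernel of the second differential of $f$ at $0$ is the axis $Ok_1$. For every $m\ge2$, the germ of $f$ has type $A_m$ if and only if $a_2=\dots=a_{m-1}=0$, $a_m\neq0$. In that case $f$ reduces to $a+a_m\tilde k_1^{m+1}+Q(\tilde k_2,\dots,\tilde k_\nu)$ near $0$ by a regular change of variables fixing the origin, where $a$ is a constant and $Q$ a nondegenerate quadratic form in $\nu-1$ variables; $f\in A_m^+$ if $a_m>0$, and $f\in A_m^-$ if $a_m<0$. Now let $f$ be a smooth even function near $0$ such that the kernel of its second differential at $0$ is the axis $Ok_1$, and put $a_{e,\mu}=a_{2\mu-1}(f)$ for $\mu\ge2$. (1) The first of these numbers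 are $$a_{e,2}=f_{y^4},\qquad a_{e,3}=f_{y^6}-10f_{z^2}^{-1}[f_{y^3z}]^2,$$ $$a_{e,4}=f_{y^8}-56f_{y^3z}f_{z^2}^{-1}\big(f_{y^5z}-5f_{y^2z^2}f_{z^2}^{-1}f_{y^3z}\big),$$ $$a_{e,5}=f_{y^{10}}-120f_{y^3z}f_{z^2}^{-1}\big(f_{y^7z}-21f_{y^2z^2}f_{z^2}^{-1}f_{y^5z}+105[f_{y^2z^2}f_{z^2}^{-1}]^2f_{y^3z}\big)-126f_{z^2}^{-1}[f_{y^5z}]^2+2100f_{y^4z^2}[f_{z^2}^{-1}f_{y^3z}]^2-2800f_{yz^3}[f_{z^2}^{-1}f_{y^3z}]^3,$$ where products are contracted over the indices $2,\dots,\nu$ of $z$ (for example $f_{z^2}^{-1}[f_{y^3z}]^2=\sum_{i,j}(f_{z^2}^{-1})_{ij}f_{y^3z_i}f_{y^3z_j}$). (2) For every $\mu\ge2$, the even germ of $f$ at $0$ has the even type $A_{e,\mu}$ if and only if $$a_{e,2}=\dots=a_{e,\mu-1}=0,\qquad a_{e,\mu}\ne0.$$ In that case $f$ reduces to the form $a+a_{e,\mu}\tilde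 k_1^{2\mu}+Q(\tilde k_2,\dots,\tilde k_\nu)$ in some neighbourhood of the origin by a regular odd change of variables $k\to\tilde k$, where $a$ is a constant and $Q$ a nondegenerate quadratic form in $\nu-1$ variables; moreover $f\in A_{e,\mu}^+$ if $a_{e,\mu}>0$, and $f\in A_{e,\mu}^-$ if $a_{e,\mu}<0$. -/

import Mathlib

open scoped ContDiff Topology

namespace EvenSing

/-- `ℝ^ν` with `ν = n + 1`. The coordinate `k 0` is `k₁`, and `Fin.tail k` is `(k₂, …, k_ν)`. -/
abbrev Space (n : ℕ) : Type := Fin (n + 1) → ℝ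

/-- The function is `C^∞` in some open neighbourhood of the origin. -/
def SmoothNearZero {n : ℕ} (f : Space n → ℝ) : Prop :=
  ∃ U : Set (Space n), IsOpen U ∧ (0 : Space n) ∈ U ∧ ContDiffOn ℝ ∞ f U

/-- The germ of the function at the origin is even. -/
def EvenNearZero {n : ℕ} (f : Space n → ℝ) : Prop :=
  ∀ᶠ k in 𝓝 (0 : Space n), f (-k) = f k

/-- The kernel of the second differential of `f` at the origin is the coordinate axis `Ok₁`. -/
def HessianKernelIsAxis {n : ℕ} (f : Space n → ℝ) : Prop :=
  LinearMap.ker (fderiv ℝ (fderiv ℝ f) (0 : Space n)).toLinearMap =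
    Submodule.span ℝ {(Pi.single 0 1 : Space n)}

/-! ### Changes of variables and equivalence of germs -/

/-- `h` represents the germ at the origin of a smooth diffeomorphism of `ℝ^ν` fixing the origin. -/
structure IsDiffeoGerm {n : ℕ} (h : OpenPartialHomeomorph (Space n) (Space n)) : Prop where
  mem_source : (0 : Space n) ∈ h.source
  map_zero : h 0 = 0
  smooth : ContDiffOn ℝ ∞ h h.source
  smooth_symm : ContDiffOn ℝ ∞ h.symm h.target

/-- `R`-equivalence of germs at the origin: `f ∘ h⁻¹ = g` near the origin
for some germ of a diffeomorphism `h` fixing the origin. -/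
def REquivalent {n : ℕ} (f g : Space n → ℝ) : Prop :=
  ∃ h : OpenPartialHomeomorph (Space n) (Space n), IsDiffeoGerm h ∧
    ∀ᶠ y in 𝓝 (0 : Space n), f (h.symm y) = g y

/-- `R_O`-equivalence (right-odd equivalence): the same with an odd `h`. -/
def ROEquivalent {n : ℕ} (f g : Space n → ℝ) : Prop :=
  ∃ h : OpenPartialHomeomorph (Space n) (Space n), IsDiffeoGerm h ∧
    (∀ᶠ x in 𝓝 (0 : Space n), h (-x) = -h x) ∧
    ∀ᶠ y in 𝓝 (0 : Space n), f (h.symm y) = g y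

/-- Nondegeneracy of a real quadratic form, through its polar bilinear form. -/
def NondegenerateForm {n : ℕ} (Q : QuadraticForm ℝ (Fin n → ℝ)) : Prop :=
  ∀ v : Fin n → ℝ, (∀ w : Fin n → ℝ, QuadraticMap.polar Q v w = 0) → v = 0

/-- The function `c + b k₁^d + Q(k₂, …, k_ν)`. -/
def normalForm {n : ℕ} (c b : ℝ) (d : ℕ) (Q : QuadraticForm ℝ (Fin n → ℝ)) : Space n → ℝ :=
  fun k => c + b * k 0 ^ d + Q (Fin.tail k)

/-- `f` reduces to `c + b k̃₁^d + Q(k̃₂, …, k̃_ν)`, with `c` a constant and `Q` a nondegenerate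
quadratic form, by a regular change of variables fixing the origin. -/
def ReducesTo {n : ℕ} (f : Space n → ℝ) (b : ℝ) (d : ℕ) : Prop :=
  ∃ (c : ℝ) (Q : QuadraticForm ℝ (Fin n → ℝ)),
    NondegenerateForm Q ∧ REquivalent f (normalForm c b d Q)

/-- The same by a regular odd change of variables. -/
def ReducesOddlyTo {n : ℕ} (f : Space n → ℝ) (b : ℝ) (d : ℕ) : Prop :=
  ∃ (c : ℝ) (Q : QuadraticForm ℝ (Fin n → ℝ)),
    NondegenerateForm Q ∧ ROEquivalent f (normalForm c b d Q)

/-- Singularity type `A_m^+`: the type of the germ `x^(m+1)`, up to adding a constant,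
adding a nondegenerate quadratic form in the remaining variables, and changing the variables. -/
def IsAPlus {n : ℕ} (m : ℕ) (f : Space n → ℝ) : Prop := ReducesTo f 1 (m + 1)

/-- Singularity type `A_m^-`: the type of the germ `-x^(m+1)`. -/
def IsAMinus {n : ℕ} (m : ℕ) (f : Space n → ℝ) : Prop := ReducesTo f (-1) (m + 1)

/-- Singularity type `A_m`. -/
def IsA {n : ℕ} (m : ℕ) (f : Space n → ℝ) : Prop := IsAPlus m f ∨ IsAMinus m f

/-- Even singularity type `A_{e,μ}^+`: the type of the even germ `x^(2μ)`, up to adding a constant,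
adding a nondegenerate quadratic form in the remaining variables, and odd changes of variables. -/
def IsAePlus {n : ℕ} (μ : ℕ) (f : Space n → ℝ) : Prop := ReducesOddlyTo f 1 (2 * μ)

/-- Even singularity type `A_{e,μ}^-`: the type of the even germ `-x^(2μ)`. -/
def IsAeMinus {n : ℕ} (μ : ℕ) (f : Space n → ℝ) : Prop := ReducesOddlyTo f (-1) (2 * μ)

/-- Even singularity type `A_{e,μ}`. -/
def IsAe {n : ℕ} (μ : ℕ) (f : Space n → ℝ) : Prop := IsAePlus μ f ∨ IsAeMinus μ f

/-! ### Partial derivatives and the numbers `a_m` -/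

/-- The iterated partial derivative of `f` along the list `w` of coordinates. -/
noncomputable def partialD {n : ℕ} : List (Fin (n + 1)) → (Space n → ℝ) → Space n → ℝ
  | [], f => f
  | i :: w, f => fun x => fderiv ℝ (partialD w f) x (Pi.single i 1)

/-- `∂^a f(0) / ∂k₁^a`. -/
noncomputable def dy {n : ℕ} (f : Space n → ℝ) (a : ℕ) : ℝ :=
  partialD (List.replicate a 0) f 0

/-- The vector `f_{y^a z}`, with `y = k₁` and `z = (k₂, …, k_ν)`. -/
noncomputable def dyz {n : ℕ} (f : Space n → ℝ) (a : ℕ) (i : Fin n) : ℝ :=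
  partialD (List.replicate a 0 ++ [i.succ]) f 0

/-- The matrix `f_{y^a z^2}`. -/
noncomputable def dyzz {n : ℕ} (f : Space n → ℝ) (a : ℕ) : Matrix (Fin n) (Fin n) ℝ :=
  Matrix.of fun i j => partialD (List.replicate a 0 ++ [i.succ, j.succ]) f 0

/-- The three-index array `f_{y^a z^3}`. -/
noncomputable def dyzzz {n : ℕ} (f : Space n → ℝ) (a : ℕ) (i j l : Fin n) : ℝ :=
  partialD (List.replicate a 0 ++ [i.succ, j.succ, l.succ]) f 0

/-- The inverse `f_{z^2}⁻¹` of the matrix `‖∂²f(0)/∂k_i∂k_j‖`, `i, j = 2, …, ν`. -/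
noncomputable def invHess {n : ℕ} (f : Space n → ℝ) : Matrix (Fin n) (Fin n) ℝ :=
  (dyzz f 0)⁻¹

/-- The indeterminates of the correction polynomials: a symbol for each iterated partial
derivative at the origin and for each component of `f_{z^2}⁻¹`. -/
inductive JetVar (n : ℕ) : Type
  | deriv (w : List (Fin (n + 1))) : JetVar n
  | inv (i j : Fin n) : JetVar n

/-- The value of the indeterminates at a function. -/
noncomputable def JetVar.value {n : ℕ} (f : Space n → ℝ) : JetVar n → ℝ
  | .deriv w => partialD w f 0
  | .inv i j => invHess f i j

/-- The indeterminates allowed in the correction term of `a_m`: the partial derivatives of order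
between `3` and `m` which are not with respect to `k₁` only, and the components of `f_{z^2}⁻¹`. -/
def JetVar.Allowed {n : ℕ} (m : ℕ) : JetVar n → Prop
  | .deriv w => 3 ≤ w.length ∧ w.length ≤ m ∧ ∃ i ∈ w, i ≠ 0
  | .inv _ _ => True

/-- The number `a_m = ∂^(m+1) f(0)/∂k₁^(m+1) + …` given by the correction polynomials `P`. -/
noncomputable def aNum {n : ℕ} (P : ℕ → MvPolynomial (JetVar n) ℤ) (f : Space n → ℝ) (m : ℕ) : ℝ :=
  dy f (m + 1) + MvPolynomial.aeval (JetVar.value f) (P m)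

/-- The number `a_{e,μ} = a_{2μ-1}`. -/
noncomputable def aeNum {n : ℕ} (P : ℕ → MvPolynomial (JetVar n) ℤ) (f : Space n → ℝ) (μ : ℕ) : ℝ :=
  aNum P f (2 * μ - 1)

/-- `s₂ = … = s_{m-1} = 0 ≠ s_m`. -/
def FirstNonzeroAt (s : ℕ → ℝ) (m : ℕ) : Prop :=
  (∀ j, 2 ≤ j → j < m → s j = 0) ∧ s m ≠ 0

/-- The numbers `a_m` given by the correction polynomials `P` are those assigned to arbitrary
(not necessarily even) functions whose second differential at the critical point `0` has kernel
`Ok₁`: the corrections are integer polynomials of the required form, the numbers detect the type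
`A_m`, and `a_m` is a coefficient of the normal form. -/
structure DeterminesTypeA (n : ℕ) (P : ℕ → MvPolynomial (JetVar n) ℤ) : Prop where
  allowed : ∀ m, 2 ≤ m → ∀ x ∈ (P m).vars, x.Allowed m
  free_term : ∀ m, 2 ≤ m → MvPolynomial.constantCoeff (P m) = 0
  type_iff : ∀ f : Space n → ℝ, SmoothNearZero f → fderiv ℝ f 0 = 0 → HessianKernelIsAxis f →
    ∀ m, 2 ≤ m → (IsA m f ↔ FirstNonzeroAt (aNum P f) m)
  reduces : ∀ f : Space n → ℝ, SmoothNearZero f → fderiv ℝ f 0 = 0 → HessianKernelIsAxis f →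
    ∀ m, 2 ≤ m → FirstNonzeroAt (aNum P f) m →
      ReducesTo f (aNum P f m) (m + 1) ∧
      (0 < aNum P f m → IsAPlus m f) ∧ (aNum P f m < 0 → IsAMinus m f)

/-! ### The tabulated values of `a_{e,μ}`

With `u = f_{z^2}⁻¹ f_{y^3z}` (a vector). -/

/-- The vector `f_{z^2}⁻¹ f_{y^3z}`. -/
noncomputable def tabU {n : ℕ} (f : Space n → ℝ) : Fin n → ℝ :=
  (invHess f).mulVec (dyz f 3)

/-- `f_{y^4}`. -/
noncomputable def tab2 {n : ℕ} (f : Space n → ℝ) : ℝ := dy f 4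

/-- `f_{y^6} - 10 f_{z^2}⁻¹ [f_{y^3z}]^2`. -/
noncomputable def tab3 {n : ℕ} (f : Space n → ℝ) : ℝ :=
  dy f 6 - 10 * (tabU f ⬝ᵥ dyz f 3)

/-- `f_{y^8} - 56 f_{y^3z} f_{z^2}⁻¹ (f_{y^5z} - 5 f_{y^2z^2} f_{z^2}⁻¹ f_{y^3z})`. -/
noncomputable def tab4 {n : ℕ} (f : Space n → ℝ) : ℝ :=
  dy f 8 - 56 * (tabU f ⬝ᵥ (dyz f 5 - (5 : ℝ) • (dyzz f 2).mulVec (tabU f)))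

/-- `f_{y^10} - 120 f_{y^3z} f_{z^2}⁻¹ (f_{y^7z} - 21 f_{y^2z^2} f_{z^2}⁻¹ f_{y^5z}
+ 105 [f_{y^2z^2} f_{z^2}⁻¹]^2 f_{y^3z}) - 126 f_{z^2}⁻¹ [f_{y^5z}]^2
+ 2100 f_{y^4z^2} [f_{z^2}⁻¹ f_{y^3z}]^2 - 2800 f_{yz^3} [f_{z^2}⁻¹ f_{y^3z}]^3`. -/
noncomputable def tab5 {n : ℕ} (f : Space n → ℝ) : ℝ :=
  dy f 10
    - 120 * (tabU f ⬝ᵥ (dyz f 7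
        - (21 : ℝ) • (dyzz f 2).mulVec ((invHess f).mulVec (dyz f 5))
        + (105 : ℝ) • (dyzz f 2).mulVec ((invHess f).mulVec ((dyzz f 2).mulVec (tabU f)))))
    - 126 * ((invHess f).mulVec (dyz f 5) ⬝ᵥ dyz f 5)
    + 2100 * (tabU f ⬝ᵥ (dyzz f 4).mulVec (tabU f))
    - 2800 * ∑ i, ∑ j, ∑ l, dyzzz f 1 i j l * tabU f i * tabU f j * tabU f l

end EvenSing

/-!
The numbers `a_m` are the derivatives of the critical value of `f` along `z`. Since the matrix
`f_{z^2}` is nondegenerate, the implicit function theorem solves `f_z(y, z) = 0` near the origin by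
a smooth curve `z = Z(y)` with `Z(0) = Z'(0) = 0`. Put `φ(y) = f(y, Z(y))` and
`a_m = φ^{(m+1)}(0)` (`critSeq`).

*Polynomials.* Differentiating `f_z(y, Z(y)) = 0` repeatedly gives linear systems with matrix
`f_{z^2}` for the Taylor coefficients of `Z`, so these are integer polynomials in the derivatives of
`f` and the entries of `f_{z^2}⁻¹` (`isJetPoly_compD`). Since `φ' = f_y(y, Z(y))`, the numbers `a_m`
are such polynomials as well, and the vanishing of `Z'(0)` and of `f_{yz}` leaves
`∂^{m+1}f/∂y^{m+1}` as the only term of order greater than `m` (`exists_correction`).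

*Reduction.* Taylor's formula with integral remainder gives
`f(y, Z(y) + v) = φ(y) + ½ B(y, v)(v, v)` with a smooth family of symmetric forms `B(y, v)`.
A smooth square root of `B` relative to `B(0, 0)` turns the second term into a constant quadratic
form, as in the Morse lemma, and if `φ(y) - φ(0) = y^{m+1} G(y)` with `G(0) ≠ 0`, a root of
`|G(y)|` is absorbed in `y` (`exists_splitting`). The construction commutes with `k ↦ -k` when `f`
is even and `m + 1` is even, because then `Z` is odd and `G` and `B` are even.

*Detection.* The germ has type `A_m` for one `m` only, and this is seen from an invariant: the
largest order to which `df` can vanish along a curve with nonzero velocity at the origin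
(`HasCriticalCurve`). It is `m` for the normal form, and if `a_2 = … = a_m = 0` the curve
`(y, Z(y))` shows that it exceeds `m`. For even `f` the function `φ` is even, so only the numbers
`a_{2μ-1}` matter.

*Tables.* For even `f`, the curve `z = -u y³/6 + q y⁵` solves `f_z = 0` up to `O(y⁶)`. The critical
value is stationary, so `f` along this curve agrees with `φ` up to `O(y¹²)`, and the derivatives of
`φ` of orders `4, 6, 8, 10` come from the Taylor expansion of `f` of degree `3` in `z`.
-/

set_option maxSynthPendingDepth 3

namespace EvenSing

open MeasureTheory Filter Set Asymptotics

/-! ### Smooth germs and integrals with parameters -/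

section Tools

variable {E F : Type} [NormedAddCommGroup E] [NormedSpace ℝ E] [FiniteDimensional ℝ E]
  [NormedAddCommGroup F] [NormedSpace ℝ F]

theorem hasFDerivAt_integral_zero_one [CompleteSpace F] {G : E × ℝ → F}
    (hG : ContDiff ℝ 1 G) (x : E) :
    HasFDerivAt (fun x => ∫ t in (0 : ℝ)..1, G (x, t))
      (∫ t in (0 : ℝ)..1, (fderiv ℝ G (x, t)).comp (ContinuousLinearMap.inl ℝ E ℝ)) x := by
  have hc : Continuous fun p : E × ℝ =>
      (fderiv ℝ G p).comp (ContinuousLinearMap.inl ℝ E ℝ) :=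
    (hG.continuous_fderiv one_ne_zero).clm_comp continuous_const
  have hK : IsCompact (Metric.closedBall x 1 ×ˢ Icc (0 : ℝ) 1) :=
    (isCompact_closedBall x 1).prod isCompact_Icc
  obtain ⟨C, hC⟩ := hK.exists_bound_of_continuousOn hc.continuousOn
  refine intervalIntegral.hasFDerivAt_integral_of_dominated_of_fderiv_le
    (F' := fun x t => (fderiv ℝ G (x, t)).comp (ContinuousLinearMap.inl ℝ E ℝ))
    (bound := fun _ => C) (Metric.ball_mem_nhds x one_pos) ?_ ?_ ?_ ?_ ?_ ?_
  · exact Eventually.of_forall fun y =>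
      (hG.continuous.comp (Continuous.prodMk_right y)).aestronglyMeasurable
  · exact (hG.continuous.comp (Continuous.prodMk_right x)).intervalIntegrable _ _
  · exact (hc.comp (Continuous.prodMk_right x)).aestronglyMeasurable
  · refine ae_of_all _ fun t ht y hy => hC (y, t) ⟨Metric.ball_subset_closedBall hy, ?_⟩
    rw [uIoc_of_le zero_le_one] at ht
    exact Ioc_subset_Icc_self ht
  · exact intervalIntegrable_const
  · refine ae_of_all _ fun t _ y _ => ?_
    have h1 : HasFDerivAt G (fderiv ℝ G (y, t)) (y, t) :=
      (hG.differentiable one_ne_zero _).hasFDerivAt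
    exact h1.comp y (hasFDerivAt_prodMk_left y t)

/-- The target is quantified inside the induction, because the derivative of the integrand takes
values in `E →L[ℝ] F`. -/
theorem contDiff_integral_zero_one_nat (n : ℕ) :
    ∀ {F : Type} [NormedAddCommGroup F] [NormedSpace ℝ F] [CompleteSpace F] {G : E × ℝ → F},
    ContDiff ℝ ∞ G →
    ContDiff ℝ n fun x => ∫ t in (0 : ℝ)..1, G (x, t) := by
  induction n with
  | zero =>
    intro F _ _ _ G hG
    refine contDiff_zero.2 (continuous_iff_continuousAt.2 fun x => ?_)
    exact (hasFDerivAt_integral_zero_one (hG.of_le (by simp)) x).continuousAt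
  | succ n ih =>
    intro F _ _ _ G hG
    have h := hasFDerivAt_integral_zero_one (hG.of_le (by simp) : ContDiff ℝ 1 G)
    refine contDiff_succ_iff_hasFDerivAt.2 ⟨_, ?_, h⟩
    exact ih ((hG.fderiv_right (by simp)).clm_comp contDiff_const)

theorem contDiff_integral_zero_one [CompleteSpace F] {G : E × ℝ → F} (hG : ContDiff ℝ ∞ G) :
    ContDiff ℝ ∞ fun x => ∫ t in (0 : ℝ)..1, G (x, t) :=
  contDiff_infty.2 fun n => contDiff_integral_zero_one_nat n hG

/-- A germ of a smooth function at the origin has a representative which is smooth everywhere,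
and an even one if the germ is even. -/
theorem exists_contDiff_eventuallyEq {h : E → F} (hh : ∀ᶠ x in 𝓝 (0 : E), ContDiffAt ℝ ∞ h x) :
    ∃ h' : E → F, ContDiff ℝ ∞ h' ∧ h' =ᶠ[𝓝 0] h ∧
      ((∀ᶠ x in 𝓝 (0 : E), h (-x) = h x) → ∀ x, h' (-x) = h' x) := by
  have key : ∀ U ∈ 𝓝 (0 : E), (∀ x ∈ U, ContDiffAt ℝ ∞ h x) →
      ∃ h' : E → F, ContDiff ℝ ∞ h' ∧ h' =ᶠ[𝓝 0] h ∧
        ((∀ x ∈ U, h (-x) = h x) → ∀ x, h' (-x) = h' x) := by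
    intro U hU hs
    obtain ⟨r, hr, hrU⟩ := Metric.mem_nhds_iff.1 hU
    -- The germ is cut off by a radial, hence even, bump function.
    let χ : ContDiffBump (0 : E) := ⟨r / 4, r / 2, by positivity, by linarith⟩
    refine ⟨fun x => χ x • h x, ?_, ?_, ?_⟩
    · refine contDiff_iff_contDiffAt.2 fun x => ?_
      by_cases hx : x ∈ Metric.ball (0 : E) r
      · exact χ.contDiffAt.smul (hs x (hrU hx))
      · have : x ∈ (Metric.closedBall (0 : E) (r / 2))ᶜ := by
          simp only [Metric.mem_ball, dist_zero_right, not_lt, mem_compl_iff,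
            Metric.mem_closedBall, not_le] at hx ⊢
          linarith
        refine (contDiffAt_const (c := (0 : F))).congr_of_eventuallyEq ?_
        filter_upwards [Metric.isClosed_closedBall.isOpen_compl.mem_nhds this] with y hy
        have : χ y = 0 := χ.zero_of_le_dist (by
          simp only [mem_compl_iff, Metric.mem_closedBall, not_le] at hy
          exact hy.le)
        simp [this]
    · filter_upwards [χ.eventuallyEq_one] with x hx
      simp [hx]
    · intro he x
      have h1 : χ (-x) = χ x := χ.neg x
      simp only [h1]
      by_cases hx : x ∈ Metric.ball (0 : E) r
      · rw [he x (hrU hx)]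
      · have : χ x = 0 := χ.zero_of_le_dist (by
          simp only [Metric.mem_ball, not_lt] at hx
          exact le_trans (by change r / 2 ≤ r; linarith) hx)
        simp [this]
  by_cases he : ∀ᶠ x in 𝓝 (0 : E), h (-x) = h x
  · obtain ⟨h', h1, h2, h3⟩ := key {x | ContDiffAt ℝ ∞ h x ∧ h (-x) = h x} (hh.and he)
      fun x hx => hx.1
    exact ⟨h', h1, h2, fun _ => h3 fun x hx => hx.2⟩
  · obtain ⟨h', h1, h2, -⟩ := key {x | ContDiffAt ℝ ∞ h x} hh fun x hx => hx
    exact ⟨h', h1, h2, fun h => absurd h he⟩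

/-- The inverse function theorem for germs of smooth maps: the local inverse is smooth in a
whole neighbourhood. -/
theorem exists_openPartialHomeomorph_of_contDiffAt {E F : Type} [NormedAddCommGroup E]
    [NormedSpace ℝ E] [CompleteSpace E] [NormedAddCommGroup F] [NormedSpace ℝ F]
    {H : E → F} {a : E}
    (hH : ∀ᶠ x in 𝓝 a, ContDiffAt ℝ ∞ H x) (H' : E ≃L[ℝ] F)
    (hd : HasFDerivAt H (H' : E →L[ℝ] F) a) :
    ∃ e : OpenPartialHomeomorph E F, a ∈ e.source ∧ (∀ x, e x = H x) ∧
      ContDiffOn ℝ ∞ H e.source ∧ ContDiffOn ℝ ∞ e.symm e.target := by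
  have ha : ContDiffAt ℝ ∞ H a := hH.self_of_nhds
  have hinf : (∞ : WithTop ℕ∞) ≠ 0 := by simp
  let e0 := ha.toOpenPartialHomeomorph H hd hinf
  have hcont : ContinuousAt (fderiv ℝ H) a := (ha.fderiv_right (m := 0) (by simp)).continuousAt
  have hinv : ∀ᶠ x in 𝓝 a, fderiv ℝ H x ∈ range ((↑) : (E ≃L[ℝ] F) → E →L[ℝ] F) := by
    apply hcont
    rw [hd.fderiv]
    exact ContinuousLinearEquiv.nhds H'
  -- The source is restricted to points where the differential stays invertible.
  obtain ⟨U, hU, hUo, haU⟩ := eventually_nhds_iff.1 (hH.and hinv)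
  refine ⟨e0.restrOpen U hUo, ⟨ha.mem_toOpenPartialHomeomorph_source hd hinf, haU⟩, fun x => rfl,
    fun x hx => (hU x hx.2).1.contDiffWithinAt, fun y hy => ?_⟩
  have hx : (e0.restrOpen U hUo).symm y ∈ (e0.restrOpen U hUo).source :=
    (e0.restrOpen U hUo).map_target hy
  obtain ⟨h1, L, hL⟩ := hU _ hx.2
  refine ((e0.restrOpen U hUo).contDiffAt_symm (f₀' := L) hy ?_ h1).contDiffWithinAt
  rw [hL]
  exact (h1.differentiableAt hinf).hasFDerivAt

end Tools

/-! ### The curve of critical points along the second factor -/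

section Splitting

variable {V : Type} [NormedAddCommGroup V] [NormedSpace ℝ V]

/-- The differential of `g : ℝ × V → ℝ` in the direction of `V`. -/
noncomputable def dz (g : ℝ × V → ℝ) (p : ℝ × V) : V →L[ℝ] ℝ :=
  (fderiv ℝ g p).comp (ContinuousLinearMap.inr ℝ ℝ V)

/-- The second differential of `g : ℝ × V → ℝ` in the direction of `V`. -/
noncomputable def dzz (g : ℝ × V → ℝ) (p : ℝ × V) : V →L[ℝ] V →L[ℝ] ℝ :=
  (fderiv ℝ (dz g) p).comp (ContinuousLinearMap.inr ℝ ℝ V)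

theorem contDiff_dz {g : ℝ × V → ℝ} (hg : ContDiff ℝ ∞ g) : ContDiff ℝ ∞ (dz g) :=
  (hg.fderiv_right (by simp)).clm_comp contDiff_const

theorem contDiff_dzz {g : ℝ × V → ℝ} (hg : ContDiff ℝ ∞ g) : ContDiff ℝ ∞ (dzz g) :=
  ((contDiff_dz hg).fderiv_right (by simp)).clm_comp contDiff_const

theorem fderiv_dz_apply {g : ℝ × V → ℝ} (hg : ContDiff ℝ ∞ g) (p q : ℝ × V) (w : V) :
    fderiv ℝ (dz g) p q w = fderiv ℝ (fderiv ℝ g) p q (0, w) := by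
  have h1 : HasFDerivAt (fderiv ℝ g) (fderiv ℝ (fderiv ℝ g) p) p :=
    (((hg.fderiv_right (m := ∞) (by simp)).differentiable (by simp)) p).hasFDerivAt
  have h2 := h1.clm_comp (hasFDerivAt_const (ContinuousLinearMap.inr ℝ ℝ V) p)
  have h3 : fderiv ℝ (dz g) p = _ := h2.fderiv
  rw [h3]
  simp

theorem dzz_symm {g : ℝ × V → ℝ} (hg : ContDiff ℝ ∞ g) (p : ℝ × V) (v w : V) :
    dzz g p v w = dzz g p w v := by
  have h : IsSymmSndFDerivAt ℝ g p := hg.contDiffAt.isSymmSndFDerivAt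
    (by rw [minSmoothness_of_isRCLikeNormedField]; exact WithTop.coe_le_coe.2 le_top)
  simp only [dzz, ContinuousLinearMap.comp_apply, ContinuousLinearMap.inr_apply,
    fderiv_dz_apply hg]
  exact h.eq _ _

theorem fderiv_comp_neg_apply {E F : Type} [NormedAddCommGroup E] [NormedSpace ℝ E]
    [NormedAddCommGroup F] [NormedSpace ℝ F] {g : E → F} (hg : ContDiff ℝ ∞ g) (p : E) :
    fderiv ℝ (fun x => g (-x)) p = -fderiv ℝ g (-p) := by
  have h1 : HasFDerivAt g (fderiv ℝ g (-p)) (-p) :=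
    (hg.differentiable (by simp) _).hasFDerivAt
  have h2 := h1.comp p (hasFDerivAt_id p).neg
  refine h2.fderiv.trans ?_
  ext v
  simp

theorem dz_neg {g : ℝ × V → ℝ} (hg : ContDiff ℝ ∞ g) (he : ∀ p, g (-p) = g p) (p : ℝ × V) :
    dz g (-p) = -dz g p := by
  have h : fderiv ℝ (fun x => g (-x)) p = -fderiv ℝ g (-p) := fderiv_comp_neg_apply hg p
  simp only [he] at h
  have h' : fderiv ℝ g (-p) = -fderiv ℝ g p := by rw [h, neg_neg]
  simp [dz, h']

theorem dzz_neg {g : ℝ × V → ℝ} (hg : ContDiff ℝ ∞ g) (he : ∀ p, g (-p) = g p) (p : ℝ × V) :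
    dzz g (-p) = dzz g p := by
  have h : fderiv ℝ (fun x => dz g (-x)) p = -fderiv ℝ (dz g) (-p) :=
    fderiv_comp_neg_apply (contDiff_dz hg) p
  simp only [dz_neg hg he, fderiv_fun_neg] at h
  ext v w
  have h1 := congrArg (fun L : ℝ × V →L[ℝ] V →L[ℝ] ℝ => L (0, v) w) h
  simpa [dzz] using h1.symm

/-- The second differential along `V` is nondegenerate at the origin, and it has no mixed part. -/
structure SplitsAt (g : ℝ × V → ℝ) (B₀ : V ≃L[ℝ] V →L[ℝ] ℝ) : Prop where
  smooth : ContDiff ℝ ∞ g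
  crit : dz g 0 = 0
  hess : dzz g 0 = B₀
  mixed : fderiv ℝ (dz g) 0 (1, 0) = 0

/-- The map `(y, z) ↦ (y, g_z(y, z))`. -/
noncomputable def gradMap (g : ℝ × V → ℝ) (p : ℝ × V) : ℝ × (V →L[ℝ] ℝ) := (p.1, dz g p)

theorem SplitsAt.hasStrictFDerivAt {g : ℝ × V → ℝ} {B₀ : V ≃L[ℝ] V →L[ℝ] ℝ} (h : SplitsAt g B₀) :
    HasStrictFDerivAt (gradMap g)
      (((ContinuousLinearEquiv.refl ℝ ℝ).prodCongr B₀ : (ℝ × V) ≃L[ℝ] ℝ × (V →L[ℝ] ℝ)) :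
        (ℝ × V) →L[ℝ] ℝ × (V →L[ℝ] ℝ)) 0 := by
  have h1 : HasStrictFDerivAt (dz g) (fderiv ℝ (dz g) 0) 0 :=
    (contDiff_dz h.smooth).contDiffAt.hasStrictFDerivAt (by simp)
  convert! hasStrictFDerivAt_fst.prodMk h1 using 1
  ext p
  · simp
  · simpa using (congrArg (fun L : V →L[ℝ] ℝ => L p) h.mixed).symm
  · simp
  · simp [← h.hess, dzz]

/-- Near the origin `g_z(y, ·)` has a Lipschitz inverse, uniformly in `y`. Hence critical points
along `V` are unique, and approximate ones are close to them. -/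
theorem SplitsAt.exists_bound {g : ℝ × V → ℝ} {B₀ : V ≃L[ℝ] V →L[ℝ] ℝ} (h : SplitsAt g B₀) :
    ∃ C : ℝ, ∀ᶠ q in 𝓝 ((0, 0) : (ℝ × V) × (ℝ × V)), q.1.1 = q.2.1 →
      ‖q.1.2 - q.2.2‖ ≤ C * ‖dz g q.1 - dz g q.2‖ := by
  have hind := (ContinuousLinearEquiv.toHomeomorph
    ((ContinuousLinearEquiv.refl ℝ ℝ).prodCongr B₀)).isInducing
  obtain ⟨C, hC⟩ := (h.hasStrictFDerivAt.isTheta_sub hind).isBigO_symm.bound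
  refine ⟨C, hC.mono fun q hq he => ?_⟩
  have h1 : gradMap g q.1 - gradMap g q.2 = (0, dz g q.1 - dz g q.2) := by
    simp [gradMap, he]
  rw [h1, Prod.norm_mk (0 : ℝ), norm_zero, max_eq_right (norm_nonneg _)] at hq
  exact (norm_snd_le (q.1 - q.2)).trans hq

/-- `Z` parametrizes the points near the origin which are critical along `V`. -/
structure IsCritCurve (g : ℝ × V → ℝ) (Z : ℝ → V) : Prop where
  smooth : ContDiff ℝ ∞ Z
  zero : Z 0 = 0
  deriv_zero : HasDerivAt Z 0 0
  crit : ∀ᶠ y in 𝓝 (0 : ℝ), dz g (y, Z y) = 0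

/-- The implicit function theorem for `g_z(y, z) = 0`; the velocity of the solution vanishes because
`g_{yz}(0) = 0`. -/
theorem SplitsAt.exists_isCritCurve [CompleteSpace V] {g : ℝ × V → ℝ} {B₀ : V ≃L[ℝ] V →L[ℝ] ℝ}
    (h : SplitsAt g B₀) : ∃ Z, IsCritCurve g Z := by
  have hs : ContDiff ℝ ∞ (gradMap g) := contDiff_fst.prodMk (contDiff_dz h.smooth)
  obtain ⟨e, h0, heq, -, hsymm⟩ := exists_openPartialHomeomorph_of_contDiffAt
    (Eventually.of_forall fun x => hs.contDiffAt) _ h.hasStrictFDerivAt.hasFDerivAt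
  have he0 : e 0 = 0 := by rw [heq]; simp [gradMap, h.crit]
  have ht0 : (0 : ℝ × (V →L[ℝ] ℝ)) ∈ e.target := he0 ▸ e.map_source h0
  have htgt : ∀ᶠ y in 𝓝 (0 : ℝ), ((y, 0) : ℝ × (V →L[ℝ] ℝ)) ∈ e.target := by
    have : ContinuousAt (fun y : ℝ => ((y, 0) : ℝ × (V →L[ℝ] ℝ))) 0 := by fun_prop
    exact this (e.open_target.mem_nhds ht0)
  obtain ⟨Z, hZ, hZe, -⟩ := exists_contDiff_eventuallyEq (E := ℝ)
    (h := fun y => (e.symm (y, 0)).2) (by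
      filter_upwards [htgt] with y hy
      have h1 : ContDiffAt ℝ ∞ e.symm (y, 0) :=
        (hsymm _ hy).contDiffAt (e.open_target.mem_nhds hy)
      exact contDiffAt_snd.comp y (h1.comp y (by fun_prop)))
  have hZ0 : Z 0 = 0 := by
    rw [hZe.self_of_nhds]
    have : e.symm (0, 0) = 0 := by
      have := e.left_inv h0
      rwa [he0] at this
    simp [this]
  have hcrit : ∀ᶠ y in 𝓝 (0 : ℝ), dz g (y, Z y) = 0 := by
    filter_upwards [htgt, hZe] with y hy hZy
    have h1 : gradMap g (e.symm (y, 0)) = (y, 0) := by rw [← heq]; exact e.right_inv hy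
    have h2 : e.symm (y, 0) = (y, Z y) := by
      rw [hZy]
      exact Prod.ext (congrArg Prod.fst h1 :) rfl
    rw [h2] at h1
    exact congrArg Prod.snd h1
  refine ⟨Z, hZ, hZ0, ?_, hcrit⟩
  have hd : HasDerivAt Z (deriv Z 0) 0 := (hZ.differentiable (by simp) 0).hasDerivAt
  have h1 : HasFDerivAt (dz g) (fderiv ℝ (dz g) 0) ((0 : ℝ), Z 0) := by
    rw [hZ0]
    exact ((contDiff_dz h.smooth).differentiable (by simp) _).hasFDerivAt
  have h2 := h1.comp_hasDerivAt (0 : ℝ) ((hasDerivAt_id (0 : ℝ)).prodMk hd)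
  have h3 : HasDerivAt (dz g ∘ fun y => (id y, Z y)) 0 0 :=
    (hasDerivAt_const (0 : ℝ) (0 : V →L[ℝ] ℝ)).congr_of_eventuallyEq hcrit
  have h4 := h2.unique h3
  have h5 : ((1 : ℝ), deriv Z 0) = (1, 0) + (0, deriv Z 0) := by simp
  have h6 : fderiv ℝ (dz g) 0 (0, deriv Z 0) = B₀ (deriv Z 0) := by
    have := congrArg (fun L => L (deriv Z 0)) h.hess
    simpa [dzz] using this
  rw [h5, map_add, h.mixed, zero_add, h6] at h4
  have h7 : deriv Z 0 = 0 := by simpa using h4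
  rwa [h7] at hd

/-- For even `g` the curve `y ↦ -Z(-y)` is critical too, and critical points are unique. -/
theorem IsCritCurve.odd {g : ℝ × V → ℝ} {B₀ : V ≃L[ℝ] V →L[ℝ] ℝ} {Z : ℝ → V}
    (hZ : IsCritCurve g Z) (h : SplitsAt g B₀) (he : ∀ p, g (-p) = g p) :
    ∀ᶠ y in 𝓝 (0 : ℝ), Z (-y) = -Z y := by
  obtain ⟨C, hC⟩ := h.exists_bound
  have hneg : Tendsto (fun y : ℝ => -y) (𝓝 0) (𝓝 0) := by
    simpa using (continuous_neg.tendsto (0 : ℝ))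
  have hc : ContinuousAt (fun y : ℝ => (((y, -Z (-y)), (y, Z y)) : (ℝ × V) × (ℝ × V))) 0 := by
    have := hZ.smooth.continuous
    fun_prop
  have ht : Tendsto (fun y : ℝ => (((y, -Z (-y)), (y, Z y)) : (ℝ × V) × (ℝ × V))) (𝓝 0)
      (𝓝 (0, 0)) := by
    have := hc.tendsto
    simpa only [neg_zero, hZ.zero] using! this
  filter_upwards [hZ.crit, hneg.eventually hZ.crit, ht.eventually hC] with y h1 h2 h3
  have h4 : dz g (y, -Z (-y)) = 0 := by
    have := dz_neg h.smooth he (-y, Z (-y))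
    rw [h2] at this
    simpa using this
  have h5 := h3 rfl
  simp only [h4, h1, sub_zero, norm_zero, mul_zero] at h5
  have h6 : -Z (-y) - Z y = 0 := norm_le_zero_iff.1 h5
  rw [← neg_eq_iff_eq_neg]
  exact sub_eq_zero.1 h6

end Splitting

/-! ### Square roots of bilinear forms and the quadratic remainder -/

section Morse

variable {V : Type} [NormedAddCommGroup V] [NormedSpace ℝ V]

/-- The symmetric part of a bilinear form. -/
noncomputable def symPart : (V →L[ℝ] V →L[ℝ] ℝ) →L[ℝ] V →L[ℝ] V →L[ℝ] ℝ :=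
  (1 / 2 : ℝ) • (ContinuousLinearMap.id ℝ _ +
    ((ContinuousLinearMap.flipₗᵢ ℝ V V ℝ).toContinuousLinearEquiv :
      (V →L[ℝ] V →L[ℝ] ℝ) →L[ℝ] V →L[ℝ] V →L[ℝ] ℝ))

theorem symPart_apply (S : V →L[ℝ] V →L[ℝ] ℝ) (v w : V) :
    symPart S v w = (1 / 2) * (S v w + S w v) := by
  simp [symPart]
  ring

theorem symPart_of_symm {S : V →L[ℝ] V →L[ℝ] ℝ} (h : ∀ v w, S v w = S w v) : symPart S = S := by
  ext v w
  rw [symPart_apply, h w v]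
  ring

theorem symPart_symPart (S : V →L[ℝ] V →L[ℝ] ℝ) : symPart (symPart S) = symPart S :=
  symPart_of_symm fun v w => by rw [symPart_apply, symPart_apply, add_comm]

/-- The map `X ↦ X + sym X`, which is invertible with inverse `X ↦ X - ½ sym X`. -/
noncomputable def addSymPart : (V →L[ℝ] V →L[ℝ] ℝ) ≃L[ℝ] V →L[ℝ] V →L[ℝ] ℝ :=
  ContinuousLinearEquiv.equivOfInverse (ContinuousLinearMap.id ℝ _ + symPart)
    (ContinuousLinearMap.id ℝ _ - (1 / 2 : ℝ) • symPart)
    (fun X => by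
      change X + symPart X - (1 / 2 : ℝ) • symPart (X + symPart X) = X
      rw [map_add, symPart_symPart]
      module)
    (fun X => by
      change X - (1 / 2 : ℝ) • symPart X + symPart (X - (1 / 2 : ℝ) • symPart X) = X
      rw [map_sub, map_smul, symPart_symPart]
      module)

/-- A smooth square root of symmetric bilinear forms near a nondegenerate form `B₀`: the symmetric
solution `S` of `S B₀⁻¹ S = B`, with `S = B₀` at `B = B₀`. The equation is extended to all
bilinear forms by adding the antisymmetric part of `S`, so that the inverse function theorem
applies. -/
theorem exists_sqrt_bilinear [CompleteSpace V] (B₀ : V ≃L[ℝ] V →L[ℝ] ℝ)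
    (hB₀ : ∀ v w, B₀ v w = B₀ w v) :
    ∃ S : (V →L[ℝ] V →L[ℝ] ℝ) → V →L[ℝ] V →L[ℝ] ℝ,
      (∀ᶠ B in 𝓝 (B₀ : V →L[ℝ] V →L[ℝ] ℝ), ContDiffAt ℝ ∞ S B) ∧ S B₀ = B₀ ∧
      ∀ᶠ B in 𝓝 (B₀ : V →L[ℝ] V →L[ℝ] ℝ), (∀ v w, B v w = B w v) →
        ∀ v, B₀ (B₀.symm (S B v)) (B₀.symm (S B v)) = B v v := by
  let R : (V →L[ℝ] ℝ) →L[ℝ] V := B₀.symm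
  let Ψ : (V →L[ℝ] V →L[ℝ] ℝ) → V →L[ℝ] V →L[ℝ] ℝ := fun S =>
    ((symPart S).comp R).comp (symPart S) + (S - symPart S)
  have hRB : ∀ v, R (B₀ v) = v := fun v => B₀.symm_apply_apply v
  have hBR : ∀ v, B₀ (R v) = v := fun v => B₀.apply_symm_apply v
  have hR : ∀ a b : V →L[ℝ] ℝ, a (R b) = b (R a) := fun a b => by
    rw [← hBR a, ← hBR b, hRB, hRB, hB₀]
  have hsym0 : symPart (B₀ : V →L[ℝ] V →L[ℝ] ℝ) = B₀ := symPart_of_symm hB₀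
  have hπ : ContDiff ℝ ∞ fun S : V →L[ℝ] V →L[ℝ] ℝ => symPart S :=
    (symPart (V := V)).contDiff
  have hΨ : ContDiff ℝ ∞ Ψ := by
    have h1 : ContDiff ℝ ∞ fun S : V →L[ℝ] V →L[ℝ] ℝ => (symPart S).comp R :=
      hπ.clm_comp contDiff_const
    have h2 : ContDiff ℝ ∞ fun S : V →L[ℝ] V →L[ℝ] ℝ => ((symPart S).comp R).comp (symPart S) :=
      h1.clm_comp hπ
    exact h2.add (contDiff_id.sub hπ)
  have hΨ0 : Ψ B₀ = B₀ := by
    ext v w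
    simp [Ψ, hsym0, hRB]
  have hd : HasFDerivAt Ψ ((addSymPart : (V →L[ℝ] V →L[ℝ] ℝ) ≃L[ℝ] V →L[ℝ] V →L[ℝ] ℝ) :
      (V →L[ℝ] V →L[ℝ] ℝ) →L[ℝ] V →L[ℝ] V →L[ℝ] ℝ) (B₀ : V →L[ℝ] V →L[ℝ] ℝ) := by
    have h1 : HasFDerivAt (symPart : (V →L[ℝ] V →L[ℝ] ℝ) → _) symPart
      (B₀ : V →L[ℝ] V →L[ℝ] ℝ) := symPart.hasFDerivAt
    have h2 := ((h1.clm_comp (hasFDerivAt_const R _)).clm_comp h1).add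
      ((hasFDerivAt_id (B₀ : V →L[ℝ] V →L[ℝ] ℝ)).sub h1)
    refine h2.congr_fderiv ?_
    ext X v w
    simp [hsym0, hRB, hBR, addSymPart]
    exact add_comm _ _
  obtain ⟨e, h0, he, -, hes⟩ := exists_openPartialHomeomorph_of_contDiffAt
    (Eventually.of_forall fun x => hΨ.contDiffAt) _ hd
  have he0 : e B₀ = B₀ := by rw [he, hΨ0]
  have ht : ∀ᶠ B in 𝓝 (B₀ : V →L[ℝ] V →L[ℝ] ℝ), B ∈ e.target :=
    e.open_target.mem_nhds (he0 ▸ e.map_source h0)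
  have hsymm0 : e.symm B₀ = B₀ := by
    have := e.left_inv h0
    rwa [he0] at this
  refine ⟨fun B => symPart (e.symm B), ?_, (congrArg symPart hsymm0).trans hsym0, ?_⟩
  · filter_upwards [ht] with B hB
    exact hπ.contDiffAt.comp B ((hes B hB).contDiffAt (e.open_target.mem_nhds hB))
  · filter_upwards [ht] with B hB hs v
    have h1 : Ψ (e.symm B) = B := by rw [← he, e.right_inv hB]
    set S := e.symm B
    have hsymS : ∀ v w, symPart S v w = symPart S w v := fun v w => by
      rw [symPart_apply, symPart_apply, add_comm]
    have h2 : ∀ v w, B v w = symPart S v (R (symPart S w)) + (S v w - symPart S v w) := by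
      intro v w
      conv_lhs => rw [← h1]
      simp only [Ψ, add_apply, sub_apply,
        ContinuousLinearMap.comp_apply]
      rw [hsymS _ w, hR]
    have h3 : S v v - symPart S v v = 0 := by
      rw [symPart_apply]; ring
    change B₀ (R (symPart S v)) (R (symPart S v)) = B v v
    rw [h2, hBR, h3, add_zero]

/-- Taylor's formula along `V` with integral remainder. -/
theorem taylor_along {g : ℝ × V → ℝ} (hg : ContDiff ℝ ∞ g) (y : ℝ) (z v : V) :
    g (y, z + v) = g (y, z) + dz g (y, z) v +
      ∫ t in (0 : ℝ)..1, (1 - t) * dzz g (y, z + t • v) v v := by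
  have hp : ∀ t : ℝ, HasDerivAt (fun t : ℝ => (y, z + t • v)) ((0 : ℝ), v) t := fun t => by
    have := ((hasDerivAt_id t).smul_const v).const_add z
    simpa using (hasDerivAt_const t y).prodMk this
  have h1 : ∀ t : ℝ, HasDerivAt (fun t : ℝ => g (y, z + t • v)) (dz g (y, z + t • v) v) t :=
    fun t => ((hg.differentiable (by simp) _).hasFDerivAt).comp_hasDerivAt t (hp t)
  have h2 : ∀ t : ℝ, HasDerivAt (fun t : ℝ => dz g (y, z + t • v) v)
      (dzz g (y, z + t • v) v v) t := fun t => by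
    have := (((contDiff_dz hg).differentiable (by simp) _).hasFDerivAt).comp_hasDerivAt t (hp t)
    simpa [dzz] using! this.clm_apply (hasDerivAt_const t v)
  have h3 : ∀ t : ℝ, HasDerivAt
      (fun t : ℝ => (1 - t) * dz g (y, z + t • v) v + g (y, z + t • v))
      ((1 - t) * dzz g (y, z + t • v) v v) t := fun t => by
    have := (((hasDerivAt_id t).const_sub 1).mul (h2 t)).add (h1 t)
    refine this.congr_deriv ?_
    simp
  have hc : Continuous fun t : ℝ => (1 - t) * dzz g (y, z + t • v) v v := by
    have := (contDiff_dzz hg).continuous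
    fun_prop
  rw [intervalIntegral.integral_eq_sub_of_hasDerivAt (fun t _ => h3 t)
    (hc.intervalIntegrable _ _)]
  simp only [sub_self, zero_mul, one_smul, sub_zero, one_mul, zero_smul, add_zero]
  ring

/-- The quadratic remainder of `g` along `V` at the points of the curve `Z`: with it,
`g(y, Z(y) + v) = g(y, Z(y)) + g_z(y, Z(y)) v + ½ B(y, v)(v, v)`. -/
noncomputable def remForm (g : ℝ × V → ℝ) (Z : ℝ → V) (p : ℝ × V) : V →L[ℝ] V →L[ℝ] ℝ :=
  ∫ t in (0 : ℝ)..1, (2 * (1 - t)) • dzz g (p.1, Z p.1 + t • p.2)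

theorem contDiff_remIntegrand {g : ℝ × V → ℝ} (hg : ContDiff ℝ ∞ g) {Z : ℝ → V}
    (hZ : ContDiff ℝ ∞ Z) : ContDiff ℝ ∞ fun q : (ℝ × V) × ℝ =>
      (2 * (1 - q.2)) • dzz g (q.1.1, Z q.1.1 + q.2 • q.1.2) := by
  have h1 := contDiff_dzz hg
  have h2 : ContDiff ℝ ∞ fun q : (ℝ × V) × ℝ => (q.1.1, Z q.1.1 + q.2 • q.1.2) := by fun_prop
  have h3 : ContDiff ℝ ∞ fun q : (ℝ × V) × ℝ => 2 * (1 - q.2) := by fun_prop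
  exact h3.smul (h1.comp h2)

theorem remForm_neg {g : ℝ × V → ℝ} (hg : ContDiff ℝ ∞ g) (he : ∀ p, g (-p) = g p) {Z : ℝ → V}
    {y : ℝ} (hy : Z (-y) = -Z y) (v : V) : remForm g Z (-y, -v) = remForm g Z (y, v) := by
  refine intervalIntegral.integral_congr fun t _ => ?_
  have : (-y, Z (-y) + t • -v) = -(y, Z y + t • v) := by
    rw [hy]
    ext
    · simp
    · simp [add_comm]
  simp only [this, dzz_neg hg he]

theorem remForm_apply {g : ℝ × V → ℝ} (hg : ContDiff ℝ ∞ g) {Z : ℝ → V}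
    (hZ : ContDiff ℝ ∞ Z) (p : ℝ × V) (v w : V) :
    remForm g Z p v w =
      ∫ t in (0 : ℝ)..1, 2 * (1 - t) * dzz g (p.1, Z p.1 + t • p.2) v w := by
  have hc : Continuous fun t : ℝ => (2 * (1 - t)) • dzz g (p.1, Z p.1 + t • p.2) :=
    (contDiff_remIntegrand hg hZ).continuous.comp (Continuous.prodMk_right p)
  rw [remForm, ContinuousLinearMap.intervalIntegral_apply (hc.intervalIntegrable _ _),
    ContinuousLinearMap.intervalIntegral_apply
      ((hc.clm_apply continuous_const).intervalIntegrable _ _)]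
  simp

theorem remForm_symm {g : ℝ × V → ℝ} (hg : ContDiff ℝ ∞ g) {Z : ℝ → V}
    (hZ : ContDiff ℝ ∞ Z) (p : ℝ × V) (v w : V) : remForm g Z p v w = remForm g Z p w v := by
  simp only [remForm_apply hg hZ, dzz_symm hg _ v w]

theorem remForm_zero {g : ℝ × V → ℝ} (hg : ContDiff ℝ ∞ g) {Z : ℝ → V} (hZ : ContDiff ℝ ∞ Z)
    (hZ0 : Z 0 = 0) : remForm g Z 0 = dzz g 0 := by
  ext v w
  have h1 : ∀ t : ℝ, ((0 : ℝ × V).1, Z (0 : ℝ × V).1 + t • (0 : ℝ × V).2) = 0 := fun t => by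
    simp [hZ0]
  have h2 : ∫ t in (0 : ℝ)..1, 2 * (1 - t) = 1 := by
    rw [intervalIntegral.integral_const_mul, intervalIntegral.integral_sub (by simp) (by simp)]
    norm_num
  simp only [remForm_apply hg hZ, h1]
  rw [intervalIntegral.integral_mul_const, h2, one_mul]

theorem eq_add_remForm {g : ℝ × V → ℝ} (hg : ContDiff ℝ ∞ g) {Z : ℝ → V}
    (hZ : ContDiff ℝ ∞ Z) (y : ℝ) (v : V) :
    g (y, Z y + v) = g (y, Z y) + dz g (y, Z y) v + (1 / 2) * remForm g Z (y, v) v v := by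
  rw [taylor_along hg, remForm_apply hg hZ, ← intervalIntegral.integral_const_mul]
  congr 1
  refine intervalIntegral.integral_congr fun t _ => ?_
  simp only
  ring

variable [FiniteDimensional ℝ V]

theorem contDiff_remForm {g : ℝ × V → ℝ} (hg : ContDiff ℝ ∞ g) {Z : ℝ → V}
    (hZ : ContDiff ℝ ∞ Z) : ContDiff ℝ ∞ (remForm g Z) :=
  contDiff_integral_zero_one (contDiff_remIntegrand hg hZ)

end Morse

/-! ### Splitting off a quadratic form -/

section Reduction

variable {V : Type} [NormedAddCommGroup V] [NormedSpace ℝ V] [FiniteDimensional ℝ V]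

/-- The splitting lemma: if the critical value of `g` along `V` is `c + y ^ d G(y)` with
`G(0) / b > 0`, the germ of `g` is reduced to `c + b y ^ d + ½ B₀(z, z)` by a local diffeomorphism,
which is odd if `g` and `G` are even. -/
theorem exists_splitting {g : ℝ × V → ℝ} {B₀ : V ≃L[ℝ] V →L[ℝ] ℝ} (h : SplitsAt g B₀) {Z : ℝ → V}
    (hZ : IsCritCurve g Z) {c b : ℝ} {d : ℕ} (hd : d ≠ 0) {G : ℝ → ℝ} (hG : ContDiff ℝ ∞ G)
    (hφ : ∀ y, g (y, Z y) = c + y ^ d * G y) (hb : 0 < G 0 / b) :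
    ∃ H : ℝ × V → ℝ × V, (∀ᶠ p in 𝓝 (0 : ℝ × V), ContDiffAt ℝ ∞ H p) ∧ H 0 = 0 ∧
      (∃ H' : (ℝ × V) ≃L[ℝ] ℝ × V, HasFDerivAt H (H' : ℝ × V →L[ℝ] ℝ × V) 0) ∧
      (∀ᶠ p in 𝓝 (0 : ℝ × V), g p = c + b * (H p).1 ^ d + 1 / 2 * B₀ (H p).2 (H p).2) ∧
      ((∀ p, g (-p) = g p) → (∀ᶠ y in 𝓝 (0 : ℝ), G (-y) = G y) →
        ∀ᶠ p in 𝓝 (0 : ℝ × V), H (-p) = -H p) := by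
  have : CompleteSpace V := FiniteDimensional.complete ℝ V
  have hBsymm : ∀ v w, B₀ v w = B₀ w v := fun v w => by
    have := dzz_symm h.smooth 0 v w
    rwa [h.hess] at this
  obtain ⟨S, hS, hS0, hSB⟩ := exists_sqrt_bilinear B₀ hBsymm
  let B : ℝ × V → V →L[ℝ] V →L[ℝ] ℝ := fun p => remForm g Z (p.1, p.2 - Z p.1)
  have hBs : ContDiff ℝ ∞ B := by
    have h1 : ContDiff ℝ ∞ fun p : ℝ × V => (p.1, p.2 - Z p.1) :=
      contDiff_fst.prodMk (contDiff_snd.sub (hZ.smooth.comp contDiff_fst))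
    exact (contDiff_remForm h.smooth hZ.smooth).comp h1
  have hB0 : B 0 = B₀ := by
    have : B 0 = remForm g Z 0 := by
      simp only [B, Prod.fst_zero, Prod.snd_zero, hZ.zero, sub_zero]
      rfl
    rw [this, remForm_zero h.smooth hZ.smooth hZ.zero, h.hess]
  have hBt : Tendsto B (𝓝 0) (𝓝 (B₀ : V →L[ℝ] V →L[ℝ] ℝ)) := hB0 ▸ hBs.continuous.tendsto 0
  -- The new coordinates are `y ψ(y)`, where `ψ ^ d = G / b`, and `B₀⁻¹ S(B) (z - Z(y))`, where
  -- `S(B)` is the square root of the remainder form `B`.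
  let ψ : ℝ → ℝ := fun y => (G y / b) ^ ((d : ℝ)⁻¹)
  have hpos : ∀ᶠ y in 𝓝 (0 : ℝ), 0 < G y / b :=
    (hG.continuous.div_const b).continuousAt.eventually_const_lt hb
  have hψs : ∀ᶠ y in 𝓝 (0 : ℝ), ContDiffAt ℝ ∞ ψ y := by
    filter_upwards [hpos] with y hy
    exact (hG.div_const b).contDiffAt.rpow_const_of_ne hy.ne'
  have hψ0 : ψ 0 ≠ 0 := (Real.rpow_pos_of_pos hb _).ne'
  have hfst : Tendsto (fun p : ℝ × V => p.1) (𝓝 0) (𝓝 0) := continuous_fst.tendsto 0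
  let R : (V →L[ℝ] ℝ) →L[ℝ] V := B₀.symm
  let H2 : ℝ × V → V := fun p => R (S (B p) (p.2 - Z p.1))
  have hSBs : ∀ᶠ p in 𝓝 (0 : ℝ × V), ContDiffAt ℝ ∞ (fun p => S (B p)) p := by
    filter_upwards [hBt.eventually hS] with p hp
    exact hp.comp p hBs.contDiffAt
  have hvs : ContDiff ℝ ∞ fun p : ℝ × V => p.2 - Z p.1 :=
    contDiff_snd.sub (hZ.smooth.comp contDiff_fst)
  have hH2s : ∀ᶠ p in 𝓝 (0 : ℝ × V), ContDiffAt ℝ ∞ H2 p := by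
    filter_upwards [hSBs] with p hp
    exact R.contDiff.contDiffAt.comp p (hp.clm_apply hvs.contDiffAt)
  refine ⟨fun p => (p.1 * ψ p.1, H2 p), ?_, by simp [H2, hZ.zero], ?_, ?_, ?_⟩
  · filter_upwards [hH2s, hfst.eventually hψs] with p h1 h2
    exact (contDiffAt_fst.mul (h2.comp p contDiffAt_fst)).prodMk h1
  · let L1 : ℝ ≃L[ℝ] ℝ := ContinuousLinearEquiv.unitsEquivAut ℝ (Units.mk0 (ψ 0) hψ0)
    refine ⟨L1.prodCongr (ContinuousLinearEquiv.refl ℝ V), ?_⟩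
    have h1 : HasFDerivAt (fun p : ℝ × V => p.1 * ψ p.1)
        (ψ 0 • ContinuousLinearMap.fst ℝ ℝ V) 0 := by
      have h2 : HasDerivAt ψ (deriv ψ 0) 0 :=
        (hψs.self_of_nhds.differentiableAt (by simp)).hasDerivAt
      have h3 : HasDerivAt (fun y => y * ψ y) (ψ 0) 0 := by
        simpa using! (hasDerivAt_id (0 : ℝ)).mul h2
      have h4 := HasDerivAt.comp_hasFDerivAt (0 : ℝ × V) (h₂ := fun y => y * ψ y)
        (f := Prod.fst) h3
        (hasFDerivAt_fst (𝕜 := ℝ) (E := ℝ) (F := V) (p := 0))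
      exact h4
    have hZd : HasFDerivAt Z (0 : ℝ →L[ℝ] V) 0 := by
      have := hZ.deriv_zero.hasFDerivAt
      simpa using this
    have h5 : HasFDerivAt (fun p : ℝ × V => p.2 - Z p.1) (ContinuousLinearMap.snd ℝ ℝ V) 0 := by
      have h6 := HasFDerivAt.comp (0 : ℝ × V) (f := Prod.fst) hZd
        (hasFDerivAt_fst (p := (0 : ℝ × V)))
      simpa using! (hasFDerivAt_snd (p := (0 : ℝ × V))).sub h6
    have h7 : HasFDerivAt H2 (ContinuousLinearMap.snd ℝ ℝ V) 0 := by
      have h8 : HasFDerivAt (fun p => S (B p)) (fderiv ℝ (fun p => S (B p)) 0) 0 :=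
        (hSBs.self_of_nhds.differentiableAt (by simp)).hasFDerivAt
      have h9 := R.hasFDerivAt.comp (0 : ℝ × V) (h8.clm_apply h5)
      refine h9.congr_fderiv ?_
      ext p
      · simp [hZ.zero]
      · simp [hZ.zero, hB0, hS0, R]
    convert! h1.prodMk h7 using 1
    ext p
    · simp [L1]
    · simp
    · simp
    · simp
  · filter_upwards [hfst.eventually hpos, hfst.eventually hZ.crit, hBt.eventually hSB]
      with p h1 h2 h3
    have h4 := eq_add_remForm h.smooth hZ.smooth p.1 (p.2 - Z p.1)
    rw [add_sub_cancel, h2, hφ] at h4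
    have h5 := h3 (fun v w => remForm_symm h.smooth hZ.smooth _ v w) (p.2 - Z p.1)
    have h6 : (ψ p.1) ^ d = G p.1 / b := Real.rpow_inv_natCast_pow h1.le hd
    have hb0 : b ≠ 0 := fun h0 => by simp [h0] at hb
    change g p = c + b * (p.1 * ψ p.1) ^ d + 1 / 2 * B₀ (B₀.symm _) (B₀.symm _)
    rw [h5, mul_pow, h6]
    change g p = _ at h4
    rw [h4]
    change c + p.1 ^ d * G p.1 + 0 + 1 / 2 * B p _ _ = _
    field_simp
    ring
  · intro he hGe
    filter_upwards [hfst.eventually hGe, hfst.eventually (hZ.odd h he)] with p h1 h2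
    have h3 : B (-p) = B p := by
      have h4 := remForm_neg h.smooth he h2 (p.2 - Z p.1)
      change remForm g Z (-p.1, -p.2 - Z (-p.1)) = remForm g Z (p.1, p.2 - Z p.1)
      rw [← h4, h2]
      congr 2
      abel
    ext
    · simp [ψ, h1]
    · change R (S (B (-p)) (-p.2 - Z (-p.1))) = -R (S (B p) (p.2 - Z p.1))
      rw [h3, h2, ← map_neg, ← map_neg]
      congr 2
      abel

/-- Division by `y` in the ring of smooth functions of one variable. -/
theorem exists_eq_mul_of_zero {φ : ℝ → ℝ} (hφ : ContDiff ℝ ∞ φ) (h0 : φ 0 = 0) :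
    ∃ G : ℝ → ℝ, ContDiff ℝ ∞ G ∧ ∀ y, φ y = y * G y := by
  have hd : ContDiff ℝ ∞ (deriv φ) := hφ.deriv'
  have hi : ContDiff ℝ ∞ fun q : ℝ × ℝ => deriv φ (q.2 * q.1) := by fun_prop
  refine ⟨fun y => ∫ t in (0 : ℝ)..1, deriv φ (t * y), contDiff_integral_zero_one hi, fun y => ?_⟩
  have h1 : ∀ t : ℝ, HasDerivAt (fun t => φ (t * y)) (y * deriv φ (t * y)) t := fun t => by
    have h2 := (hφ.differentiable (by simp) (t * y)).hasDerivAt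
    have h3 := h2.comp t ((hasDerivAt_id t).mul_const y)
    simpa [mul_comm] using! h3
  have hc : Continuous fun t : ℝ => y * deriv φ (t * y) := by
    have := hd.continuous
    fun_prop
  have h4 := intervalIntegral.integral_eq_sub_of_hasDerivAt (a := 0) (b := 1) (fun t _ => h1 t)
    (hc.intervalIntegrable _ _)
  rw [intervalIntegral.integral_const_mul] at h4
  simpa [h0] using h4.symm

theorem iteratedDeriv_succ_id_mul {G : ℝ → ℝ} (hG : ContDiff ℝ ∞ G) (n : ℕ) (y : ℝ) :
    iteratedDeriv (n + 1) (fun y => y * G y) y =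
      y * iteratedDeriv (n + 1) G y + (n + 1) * iteratedDeriv n G y := by
  induction n generalizing y with
  | zero =>
    have h1 := (hasDerivAt_id y).mul (hG.differentiable (by simp) y).hasDerivAt
    have h2 := h1.deriv
    simpa [iteratedDeriv_one, add_comm] using! h2
  | succ n ih =>
    have hs : ∀ k, ∀ y, HasDerivAt (iteratedDeriv k G) (iteratedDeriv (k + 1) G y) y :=
        fun k y => by
      rw [iteratedDeriv_succ]
      exact (hG.differentiable_iteratedDeriv k
        (WithTop.coe_lt_coe.2 (WithTop.coe_lt_top k)) y).hasDerivAt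
    rw [iteratedDeriv_succ, funext ih]
    have h1 := ((hasDerivAt_id y).mul (hs (n + 1) y)).add ((hs n y).const_mul ((n : ℝ) + 1))
    refine h1.deriv.trans ?_
    simp
    ring

/-- A smooth function of one variable which vanishes to order `d` at the origin is `y ^ d` times
a smooth function. -/
theorem exists_eq_pow_mul {φ : ℝ → ℝ} (hφ : ContDiff ℝ ∞ φ) (d : ℕ)
    (h : ∀ j < d, iteratedDeriv j φ 0 = 0) :
    ∃ G : ℝ → ℝ, ContDiff ℝ ∞ G ∧ (∀ y, φ y = y ^ d * G y) ∧
      iteratedDeriv d φ 0 = d.factorial * G 0 := by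
  induction d generalizing φ with
  | zero => exact ⟨φ, hφ, fun y => by simp, by simp⟩
  | succ d ih =>
    obtain ⟨G, hG, hGe⟩ := exists_eq_mul_of_zero hφ (by simpa using h 0 (by omega))
    have h1 : ∀ n, iteratedDeriv (n + 1) φ 0 = (n + 1) * iteratedDeriv n G 0 := fun n => by
      rw [funext hGe, iteratedDeriv_succ_id_mul hG]
      simp
    obtain ⟨K, hK, hKe, hK0⟩ := ih hG fun j hj => by
      have h2 := h1 j
      rw [h (j + 1) (by omega)] at h2
      rcases mul_eq_zero.1 h2.symm with h3 | h3
      · exact absurd h3 (by positivity)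
      · exact h3
    refine ⟨K, hK, fun y => by rw [hGe, hKe]; ring, ?_⟩
    rw [h1, hK0, Nat.factorial_succ]
    push_cast
    ring

end Reduction

/-! ### Partial derivatives and the curve `f_z = 0` -/

section Partial

variable {n : ℕ}

theorem clm_apply_eq_sum {ι : Type} [Fintype ι] [DecidableEq ι] (L : (ι → ℝ) →L[ℝ] ℝ)
    (v : ι → ℝ) :
    L v = ∑ i, v i * L (Pi.single i 1) := by
  conv_lhs => rw [← Finset.univ_sum_single v]
  rw [map_sum]
  refine Finset.sum_congr rfl fun i _ => ?_
  have : (Pi.single i (v i) : ι → ℝ) = v i • Pi.single i 1 := by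
    rw [← Pi.single_smul, smul_eq_mul, mul_one]
  rw [this, map_smul, smul_eq_mul]

theorem contDiff_partialD {f : Space n → ℝ} (hf : ContDiff ℝ ∞ f) (w : List (Fin (n + 1))) :
    ContDiff ℝ ∞ (partialD w f) := by
  induction w with
  | nil => exact hf
  | cons i w ih => exact (ih.fderiv_right (by simp)).clm_apply contDiff_const

theorem hasDerivAt_partialD_comp {f : Space n → ℝ} (hf : ContDiff ℝ ∞ f) (w : List (Fin (n + 1)))
    {γ : ℝ → Space n} {v : Space n} {t : ℝ} (hγ : HasDerivAt γ v t) :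
    HasDerivAt (fun t => partialD w f (γ t)) (∑ i, v i * partialD (i :: w) f (γ t)) t := by
  have h1 := ((contDiff_partialD hf w).differentiable (by simp) (γ t)).hasFDerivAt
  have h2 := h1.comp_hasDerivAt t hγ
  rw [clm_apply_eq_sum] at h2
  exact h2

theorem partialD_pair {f : Space n → ℝ} (hf : ContDiff ℝ ∞ f) (i j : Fin (n + 1)) (x : Space n) :
    partialD [i, j] f x = fderiv ℝ (fderiv ℝ f) x (Pi.single i 1) (Pi.single j 1) := by
  have h1 : HasFDerivAt (fderiv ℝ f) (fderiv ℝ (fderiv ℝ f) x) x :=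
    ((hf.fderiv_right (m := ∞) (by simp)).differentiable (by simp) x).hasFDerivAt
  have h2 := h1.clm_apply (hasFDerivAt_const (Pi.single j 1 : Space n) x)
  change fderiv ℝ (fun x => fderiv ℝ f x (Pi.single j 1)) x (Pi.single i 1) = _
  rw [h2.fderiv]
  simp

theorem sndFDeriv_symm {f : Space n → ℝ} (hf : ContDiff ℝ ∞ f) (x v w : Space n) :
    fderiv ℝ (fderiv ℝ f) x v w = fderiv ℝ (fderiv ℝ f) x w v :=
  (hf.contDiffAt.isSymmSndFDerivAt
    (by rw [minSmoothness_of_isRCLikeNormedField]; exact WithTop.coe_le_coe.2 le_top)).eq _ _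

theorem sndFDeriv_single_zero {f : Space n → ℝ} (hk : HessianKernelIsAxis f) :
    fderiv ℝ (fderiv ℝ f) (0 : Space n) (Pi.single 0 1) = 0 := by
  have h1 : (Pi.single 0 1 : Space n) ∈ Submodule.span ℝ {(Pi.single 0 1 : Space n)} :=
    Submodule.mem_span_singleton_self _
  rw [← hk] at h1
  simpa using h1

theorem partialD_zero_cons {f : Space n → ℝ} (hf : ContDiff ℝ ∞ f) (hk : HessianKernelIsAxis f)
    (j : Fin (n + 1)) : partialD [0, j] f 0 = 0 := by
  rw [partialD_pair hf, sndFDeriv_single_zero hk]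
  rfl

theorem partialD_cons_zero {f : Space n → ℝ} (hf : ContDiff ℝ ∞ f) (hk : HessianKernelIsAxis f)
    (j : Fin (n + 1)) : partialD [j, 0] f 0 = 0 := by
  rw [partialD_pair hf, sndFDeriv_symm hf, ← partialD_pair hf, partialD_zero_cons hf hk]

/-- The identification of `ℝ × ℝⁿ` with `ℝ^(n+1)`. -/
noncomputable def consL (n : ℕ) : (ℝ × (Fin n → ℝ)) ≃L[ℝ] Space n :=
  Fin.consEquivL ℝ fun _ => ℝ

theorem consL_apply (y : ℝ) (z : Fin n → ℝ) : consL n (y, z) = Fin.cons y z := rfl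

theorem consL_single (i : Fin n) : consL n (0, Pi.single i 1) = Pi.single i.succ 1 := by
  rw [consL_apply]
  ext j
  refine Fin.cases ?_ (fun j => ?_) j
  · simp
  · simp [Pi.single_apply]

theorem consL_one : consL n (1, 0) = Pi.single 0 1 := by
  rw [consL_apply]
  ext j
  refine Fin.cases ?_ (fun j => ?_) j <;> simp

theorem contDiff_comp_consL {f : Space n → ℝ} (hf : ContDiff ℝ ∞ f) :
    ContDiff ℝ ∞ (f ∘ consL n) := hf.comp (consL n).contDiff

theorem dz_comp_consL {f : Space n → ℝ} (p : ℝ × (Fin n → ℝ)) (v : Fin n → ℝ) :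
    dz (f ∘ consL n) p v = fderiv ℝ f (consL n p) (consL n (0, v)) := by
  simp [dz, (consL n).comp_right_fderiv]

theorem dz_comp_consL_single {f : Space n → ℝ} (p : ℝ × (Fin n → ℝ)) (i : Fin n) :
    dz (f ∘ consL n) p (Pi.single i 1) = partialD [i.succ] f (consL n p) := by
  rw [dz_comp_consL, consL_single]
  rfl

theorem fderiv_dz_comp_consL {f : Space n → ℝ} (hf : ContDiff ℝ ∞ f)
    (p q : ℝ × (Fin n → ℝ)) (w : Fin n → ℝ) :
    fderiv ℝ (dz (f ∘ consL n)) p q w =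
      fderiv ℝ (fderiv ℝ f) (consL n p) (consL n q) (consL n (0, w)) := by
  have h1 : HasFDerivAt (fderiv ℝ f) (fderiv ℝ (fderiv ℝ f) (consL n p)) (consL n p) :=
    ((hf.fderiv_right (m := ∞) (by simp)).differentiable (by simp) _).hasFDerivAt
  have h2 := (h1.comp p (consL n).hasFDerivAt).clm_apply (hasFDerivAt_const (consL n (0, w)) p)
  have h3 : HasFDerivAt (dz (f ∘ consL n)) (fderiv ℝ (dz (f ∘ consL n)) p) p :=
    ((contDiff_dz (contDiff_comp_consL hf)).differentiable (by simp) _).hasFDerivAt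
  have h4 := h3.clm_apply (hasFDerivAt_const w p)
  have h5 : (fun p => dz (f ∘ consL n) p w) =
      fun p => (fderiv ℝ f ∘ consL n) p (consL n (0, w)) := funext fun p => dz_comp_consL p w
  rw [h5] at h4
  have h6 := congrArg (fun L : ℝ × (Fin n → ℝ) →L[ℝ] ℝ => L q) (h4.unique h2)
  simpa using h6

theorem dzz_comp_consL_single {f : Space n → ℝ} (hf : ContDiff ℝ ∞ f)
    (p : ℝ × (Fin n → ℝ)) (i j : Fin n) :
    dzz (f ∘ consL n) p (Pi.single i 1) (Pi.single j 1) =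
      partialD [i.succ, j.succ] f (consL n p) := by
  rw [partialD_pair hf, ← consL_single, ← consL_single, ← fderiv_dz_comp_consL hf]
  rfl

theorem eq_zero_of_dzz_comp_consL {f : Space n → ℝ} (hf : ContDiff ℝ ∞ f)
    (hk : HessianKernelIsAxis f) {v : Fin n → ℝ} (hv : dzz (f ∘ consL n) 0 v = 0) : v = 0 := by
  have h1 : fderiv ℝ (fderiv ℝ f) (0 : Space n) (consL n (0, v)) = 0 := by
    ext x
    obtain ⟨⟨y, z⟩, rfl⟩ := (consL n).surjective x
    have h2 : ((y, z) : ℝ × (Fin n → ℝ)) = y • (1, 0) + (0, z) := by simp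
    rw [h2, map_add, map_smul, map_add, map_smul, consL_one, sndFDeriv_symm hf,
      sndFDeriv_single_zero hk]
    have h3 := congrArg (fun L : (Fin n → ℝ) →L[ℝ] ℝ => L z) hv
    have h4 := fderiv_dz_comp_consL hf 0 (0, v) z
    rw [map_zero] at h4
    simp only [zero_apply] at h3 ⊢
    rw [← h4]
    simpa [dzz] using h3
  have h2 : consL n (0, v) ∈ Submodule.span ℝ {(Pi.single 0 1 : Space n)} := by
    rw [← hk]
    simpa using h1
  obtain ⟨c, hc⟩ := Submodule.mem_span_singleton.1 h2
  ext i
  have h3 := congrFun hc i.succ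
  rw [consL_apply] at h3
  simpa using h3.symm

theorem exists_splitsAt {f : Space n → ℝ} (hf : ContDiff ℝ ∞ f) (h0 : fderiv ℝ f 0 = 0)
    (hk : HessianKernelIsAxis f) :
    ∃ B₀ : (Fin n → ℝ) ≃L[ℝ] (Fin n → ℝ) →L[ℝ] ℝ, SplitsAt (f ∘ consL n) B₀ := by
  let T : (Fin n → ℝ) →ₗ[ℝ] (Fin n → ℝ) →L[ℝ] ℝ := (dzz (f ∘ consL n) 0).toLinearMap
  have hinj : Function.Injective T := by
    rw [← LinearMap.ker_eq_bot, LinearMap.ker_eq_bot']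
    exact fun v hv => eq_zero_of_dzz_comp_consL hf hk hv
  have hfin : Module.finrank ℝ (Fin n → ℝ) = Module.finrank ℝ ((Fin n → ℝ) →L[ℝ] ℝ) := by
    rw [← (LinearMap.toContinuousLinearMap :
      ((Fin n → ℝ) →ₗ[ℝ] ℝ) ≃ₗ[ℝ] ((Fin n → ℝ) →L[ℝ] ℝ)).finrank_eq]
    exact (Subspace.dual_finrank_eq).symm
  refine ⟨(LinearEquiv.ofInjectiveOfFinrankEq T hinj hfin).toContinuousLinearEquiv,
    contDiff_comp_consL hf, ?_, ?_, ?_⟩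
  · ext1 v
    rw [dz_comp_consL, map_zero, h0]
    rfl
  · ext v w
    rfl
  · ext1 w
    rw [fderiv_dz_comp_consL hf, consL_one, map_zero, sndFDeriv_single_zero hk]
    rfl

/-- `f` is a smooth function whose second differential at the critical point `0` has kernel
`Ok₁`, and the graph of `Z` consists, near the origin, of the points where `f_z = 0`. -/
structure IsAdmissible (f : Space n → ℝ) (Z : ℝ → Fin n → ℝ) : Prop where
  smooth : ContDiff ℝ ∞ f
  crit : fderiv ℝ f 0 = 0
  ker : HessianKernelIsAxis f
  curve : IsCritCurve (f ∘ consL n) Z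

theorem exists_isAdmissible {f : Space n → ℝ} (hf : ContDiff ℝ ∞ f) (h0 : fderiv ℝ f 0 = 0)
    (hk : HessianKernelIsAxis f) : ∃ Z, IsAdmissible f Z := by
  obtain ⟨B₀, hB⟩ := exists_splitsAt hf h0 hk
  obtain ⟨Z, hZ⟩ := hB.exists_isCritCurve
  exact ⟨Z, hf, h0, hk, hZ⟩

/-- The restriction of `F` to the curve `z = Z(y)`. -/
def alongCurve (Z : ℝ → Fin n → ℝ) (F : Space n → ℝ) (y : ℝ) : ℝ := F (Fin.cons y (Z y))

variable {f : Space n → ℝ} {Z : ℝ → Fin n → ℝ}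

namespace IsAdmissible

theorem alongCurve_zero (h : IsAdmissible f Z) (F : Space n → ℝ) : alongCurve Z F 0 = F 0 := by
  have : (Fin.cons 0 (Z 0) : Space n) = 0 := by
    rw [h.curve.zero, ← consL_apply]
    exact map_zero _
  rw [alongCurve, this]

theorem contDiff_alongCurve (h : IsAdmissible f Z) {F : Space n → ℝ} (hF : ContDiff ℝ ∞ F) :
    ContDiff ℝ ∞ (alongCurve Z F) :=
  hF.comp ((consL n).contDiff.comp (contDiff_id.prodMk h.curve.smooth))

theorem hasDerivAt_alongCurve (h : IsAdmissible f Z) (w : List (Fin (n + 1))) (y : ℝ) :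
    HasDerivAt (alongCurve Z (partialD w f)) (alongCurve Z (partialD (0 :: w) f) y +
      ∑ i, deriv (fun y => Z y i) y * alongCurve Z (partialD (i.succ :: w) f) y) y := by
  have hZ : ∀ i, HasDerivAt (fun y => Z y i) (deriv (fun y => Z y i) y) y := fun i =>
    ((contDiff_pi.1 h.curve.smooth i).differentiable (by simp) y).hasDerivAt
  have h1 : HasDerivAt (fun y => (Fin.cons y (Z y) : Space n))
      (Fin.cons 1 fun i => deriv (fun y => Z y i) y) y := by
    rw [hasDerivAt_pi]
    intro i
    refine Fin.cases ?_ (fun i => ?_) i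
    · simpa using! hasDerivAt_id y
    · simpa using hZ i
  have h2 := hasDerivAt_partialD_comp h.smooth w h1
  rw [Fin.sum_univ_succ] at h2
  simpa using! h2

theorem alongCurve_succ_eventually (h : IsAdmissible f Z) (i : Fin n) :
    ∀ᶠ y in 𝓝 (0 : ℝ), alongCurve Z (partialD [i.succ] f) y = 0 := by
  filter_upwards [h.curve.crit] with y hy
  have := dz_comp_consL_single (f := f) (y, Z y) i
  rw [hy] at this
  exact this.symm

theorem deriv_alongCurve (h : IsAdmissible f Z) :
    deriv (alongCurve Z f) =ᶠ[𝓝 0] alongCurve Z (partialD [0] f) := by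
  filter_upwards [eventually_all.2 h.alongCurve_succ_eventually] with y hy
  refine (h.hasDerivAt_alongCurve [] y).deriv.trans ?_
  rw [Finset.sum_eq_zero fun i _ => by rw [hy i, mul_zero], add_zero]

theorem iteratedDeriv_succ_alongCurve (h : IsAdmissible f Z) (m : ℕ) :
    iteratedDeriv (m + 1) (alongCurve Z f) 0 =
      iteratedDeriv m (alongCurve Z (partialD [0] f)) 0 := by
  rw [iteratedDeriv_succ']
  exact h.deriv_alongCurve.iteratedDeriv_eq m

theorem deriv_Z_zero (h : IsAdmissible f Z) (i : Fin n) : deriv (fun y => Z y i) 0 = 0 :=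
  (hasDerivAt_pi.1 h.curve.deriv_zero i).deriv

theorem iteratedDeriv_one_eq_zero (h : IsAdmissible f Z) :
    iteratedDeriv 1 (alongCurve Z f) 0 = 0 := by
  rw [h.iteratedDeriv_succ_alongCurve 0, iteratedDeriv_zero, h.alongCurve_zero]
  change fderiv ℝ f 0 _ = 0
  rw [h.crit]
  rfl

theorem iteratedDeriv_two_eq_zero (h : IsAdmissible f Z) :
    iteratedDeriv 2 (alongCurve Z f) 0 = 0 := by
  rw [h.iteratedDeriv_succ_alongCurve 1, iteratedDeriv_one, (h.hasDerivAt_alongCurve [0] 0).deriv]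
  simp [h.alongCurve_zero, h.deriv_Z_zero, partialD_zero_cons h.smooth h.ker]

end IsAdmissible

end Partial

/-! ### Reduction to the normal form -/

section Types

variable {n : ℕ} {f : Space n → ℝ} {Z : ℝ → Fin n → ℝ}

/-- The derivatives of the critical value `y ↦ f(y, Z(y))` at the origin, numbered as the `a_m`. -/
noncomputable def critSeq (f : Space n → ℝ) (Z : ℝ → Fin n → ℝ) (m : ℕ) : ℝ :=
  iteratedDeriv (m + 1) (alongCurve Z f) 0

theorem IsAdmissible.alongCurve_neg (h : IsAdmissible f Z) (he : ∀ x, f (-x) = f x) :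
    ∀ᶠ y in 𝓝 (0 : ℝ), alongCurve Z f (-y) = alongCurve Z f y := by
  obtain ⟨B₀, hB⟩ := exists_splitsAt h.smooth h.crit h.ker
  filter_upwards [h.curve.odd hB fun p => by simp [he]] with y hy
  have h2 : (Fin.cons (-y) (Z (-y)) : Space n) = -Fin.cons y (Z y) := by
    rw [hy, ← consL_apply, ← consL_apply, ← map_neg]
    rfl
  rw [alongCurve, h2, he]
  rfl

/-- The change of variables to the normal form. The coefficient `b` may be any number of the sign of
`a_m`: the choices `a_m` and `±1` are used below. -/
theorem IsAdmissible.exists_normalForm (h : IsAdmissible f Z) {m : ℕ}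
    (hm : ∀ j, 2 ≤ j → j < m → critSeq f Z j = 0) {b : ℝ} (hb : 0 < critSeq f Z m / b) :
    ∃ (c : ℝ) (Q : QuadraticForm ℝ (Fin n → ℝ)) (k : OpenPartialHomeomorph (Space n) (Space n)),
      NondegenerateForm Q ∧ IsDiffeoGerm k ∧
      (∀ᶠ y in 𝓝 (0 : Space n), f (k.symm y) = normalForm c b (m + 1) Q y) ∧
      ((∀ x, f (-x) = f x) → Even (m + 1) → ∀ᶠ x in 𝓝 (0 : Space n), k (-x) = -k x) := by
  obtain ⟨B₀, hB⟩ := exists_splitsAt h.smooth h.crit h.ker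
  have hs : ContDiff ℝ ∞ (alongCurve Z f) := h.contDiff_alongCurve h.smooth
  have hpos : ∀ j, iteratedDeriv (j + 1) (fun y => alongCurve Z f y - alongCurve Z f 0) 0 =
      iteratedDeriv (j + 1) (alongCurve Z f) 0 := fun j => by
    rw [iteratedDeriv_succ', iteratedDeriv_succ']
    simp
  obtain ⟨G, hG, hGe, hG0⟩ := exists_eq_pow_mul (hs.sub contDiff_const) (m + 1)
    (φ := fun y => alongCurve Z f y - alongCurve Z f 0) (fun j hj => by
      match j with
      | 0 => simp
      | 1 => rw [hpos, h.iteratedDeriv_one_eq_zero]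
      | 2 => rw [hpos, h.iteratedDeriv_two_eq_zero]
      | j + 3 => rw [hpos]; exact hm (j + 2) (by omega) (by omega))
  rw [hpos] at hG0
  have hb' : 0 < G 0 / b := by
    have h1 : critSeq f Z m / b = (m + 1).factorial * (G 0 / b) := by
      rw [critSeq, hG0]; ring
    rw [h1] at hb
    exact pos_of_mul_pos_right hb (by positivity)
  obtain ⟨H, hHs, hH0, ⟨H', hH'⟩, hHf, hHodd⟩ := exists_splitting hB h.curve (Nat.succ_ne_zero m) hG
    (c := alongCurve Z f 0) (fun y => by
      rw [← hGe]
      change alongCurve Z f y = _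
      ring) hb'
  have hsymm0 : Tendsto (consL n).symm (𝓝 0) (𝓝 0) := by
    simpa using (consL n).symm.continuous.tendsto 0
  let K : Space n → Space n := fun x => consL n (H ((consL n).symm x))
  have hK : ∀ᶠ x in 𝓝 (0 : Space n), ContDiffAt ℝ ∞ K x := by
    filter_upwards [hsymm0.eventually hHs] with x hx
    exact (consL n).contDiff.contDiffAt.comp x (hx.comp x (consL n).symm.contDiff.contDiffAt)
  have hK' : HasFDerivAt K
      (((consL n).symm.trans (H'.trans (consL n)) : Space n ≃L[ℝ] Space n) :
        Space n →L[ℝ] Space n) 0 := by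
    have h1 : HasFDerivAt H (H' : ℝ × (Fin n → ℝ) →L[ℝ] ℝ × (Fin n → ℝ)) ((consL n).symm 0) := by
      rwa [map_zero]
    exact (consL n).hasFDerivAt.comp (0 : Space n)
      (h1.comp (0 : Space n) (consL n).symm.hasFDerivAt)
  obtain ⟨k, hk0, hkK, hks, hks'⟩ := exists_openPartialHomeomorph_of_contDiffAt hK _ hK'
  have hk00 : k 0 = 0 := by rw [hkK]; simp [K, hH0]
  have hks0 : k.symm 0 = 0 := by
    have := k.left_inv hk0
    rwa [hk00] at this
  have ht0 : (0 : Space n) ∈ k.target := hk00 ▸ k.map_source hk0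
  let BL : LinearMap.BilinMap ℝ (Fin n → ℝ) ℝ :=
    (1 / 2 : ℝ) • (ContinuousLinearMap.coeLM ℝ ∘ₗ
      (B₀ : (Fin n → ℝ) →L[ℝ] (Fin n → ℝ) →L[ℝ] ℝ).toLinearMap)
  have hBL : ∀ v w, BL v w = 1 / 2 * B₀ v w := fun v w => rfl
  refine ⟨alongCurve Z f 0, BL.toQuadraticMap, k, ?_, ⟨hk0, hk00, ?_, hks'⟩, ?_, ?_⟩
  · intro v hv
    have h1 : B₀ v = 0 := by
      ext1 w
      have h2 := hv w
      rw [LinearMap.BilinMap.polar_toQuadraticMap, hBL, hBL] at h2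
      have h3 : B₀ v w = B₀ w v := by
        have := dzz_symm hB.smooth 0 v w
        rwa [hB.hess] at this
      rw [← h3] at h2
      simp only [zero_apply]
      linarith
    simpa using h1
  · exact hks.congr fun x _ => hkK x
  · have hcont : Tendsto k.symm (𝓝 0) (𝓝 0) := by
      have := (k.continuousAt_symm ht0).tendsto
      rwa [hks0] at this
    filter_upwards [(hsymm0.comp hcont).eventually hHf, k.open_target.mem_nhds ht0] with y h1 h2
    have h3 : K (k.symm y) = y := by rw [← hkK]; exact k.right_inv h2
    have h4 : H ((consL n).symm (k.symm y)) = (consL n).symm y :=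
      (consL n).injective (h3.trans ((consL n).apply_symm_apply y).symm)
    simp only [Function.comp_apply, ContinuousLinearEquiv.apply_symm_apply, h4] at h1
    rw [h1]
    rfl
  · intro he hm'
    have hGeven : ∀ᶠ y in 𝓝 (0 : ℝ), G (-y) = G y := by
      filter_upwards [h.alongCurve_neg he] with y h1
      rcases eq_or_ne y 0 with rfl | hy0
      · simp
      · have h3 := hGe (-y)
        rw [h1, hGe y, hm'.neg_pow] at h3
        exact (mul_left_cancel₀ (pow_ne_zero _ hy0) h3).symm
    filter_upwards [hsymm0.eventually (hHodd (fun p => by simp [he]) hGeven)] with x hx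
    rw [hkK, hkK]
    simp only [K, map_neg, hx]

theorem IsAdmissible.reducesTo (h : IsAdmissible f Z) {m : ℕ}
    (hm : ∀ j, 2 ≤ j → j < m → critSeq f Z j = 0) {b : ℝ} (hb : 0 < critSeq f Z m / b) :
    ReducesTo f b (m + 1) := by
  obtain ⟨c, Q, k, hQ, hk, hf, -⟩ := h.exists_normalForm hm hb
  exact ⟨c, Q, hQ, k, hk, hf⟩

theorem IsAdmissible.reducesOddlyTo (h : IsAdmissible f Z) (he : ∀ x, f (-x) = f x) {m : ℕ}
    (hm' : Even (m + 1)) (hm : ∀ j, 2 ≤ j → j < m → critSeq f Z j = 0) {b : ℝ}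
    (hb : 0 < critSeq f Z m / b) : ReducesOddlyTo f b (m + 1) := by
  obtain ⟨c, Q, k, hQ, hk, hf, ho⟩ := h.exists_normalForm hm hb
  exact ⟨c, Q, hQ, k, hk, ho he hm', hf⟩

/-! ### Order of contact of the gradient with regular curves -/

/-- Some regular curve through the origin meets the critical set of `f` to order at least `m`:
the differential of `f` along it is `O(t ^ m)`. This property is invariant under changes
of variables. -/
def HasCriticalCurve (m : ℕ) (f : Space n → ℝ) : Prop :=
  ∃ (γ : ℝ → Space n) (v : Space n), γ 0 = 0 ∧ HasDerivAt γ v 0 ∧ v ≠ 0 ∧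
    (fun t => fderiv ℝ f (γ t)) =O[𝓝 0] fun t => t ^ m

theorem isBigO_pow_of_le {m k : ℕ} (hmk : k ≤ m) :
    (fun t : ℝ => t ^ m) =O[𝓝 0] fun t => t ^ k := by
  have h1 : (fun t : ℝ => t ^ (m - k)) =O[𝓝 0] fun _ => (1 : ℝ) :=
    (continuous_pow (m - k)).continuousAt.isBigO_one ℝ
  have h2 := (isBigO_refl (fun t : ℝ => t ^ k) (𝓝 0)).mul h1
  simpa only [← pow_add, Nat.add_sub_cancel' hmk, mul_one] using h2

theorem HasCriticalCurve.mono {m k : ℕ} (hmk : k ≤ m) (h : HasCriticalCurve m f) :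
    HasCriticalCurve k f := by
  obtain ⟨γ, v, h0, hd, hv, hO⟩ := h
  exact ⟨γ, v, h0, hd, hv, hO.trans (isBigO_pow_of_le hmk)⟩

theorem IsDiffeoGerm.symm {k : OpenPartialHomeomorph (Space n) (Space n)} (hk : IsDiffeoGerm k) :
    IsDiffeoGerm k.symm := by
  have h1 : (0 : Space n) ∈ k.target := by
    have := k.map_source hk.mem_source
    rwa [hk.map_zero] at this
  have h2 : k.symm 0 = 0 := by
    have := k.left_inv hk.mem_source
    rwa [hk.map_zero] at this
  exact ⟨h1, h2, hk.smooth_symm, hk.smooth⟩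

theorem IsDiffeoGerm.contDiffAt {k : OpenPartialHomeomorph (Space n) (Space n)}
    (hk : IsDiffeoGerm k) : ∀ᶠ x in 𝓝 (0 : Space n), ContDiffAt ℝ ∞ k x := by
  filter_upwards [k.open_source.mem_nhds hk.mem_source] with x hx
  exact (hk.smooth x hx).contDiffAt (k.open_source.mem_nhds hx)

theorem IsDiffeoGerm.tendsto {k : OpenPartialHomeomorph (Space n) (Space n)}
    (hk : IsDiffeoGerm k) : Tendsto k (𝓝 0) (𝓝 0) := by
  have := hk.contDiffAt.self_of_nhds.continuousAt.tendsto
  rwa [hk.map_zero] at this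

theorem HasCriticalCurve.comp {m : ℕ} {g : Space n → ℝ} (hg : Differentiable ℝ g)
    (h : HasCriticalCurve m g) {k : OpenPartialHomeomorph (Space n) (Space n)}
    (hk : IsDiffeoGerm k) (hf : ∀ᶠ x in 𝓝 (0 : Space n), f x = g (k x)) :
    HasCriticalCurve m f := by
  obtain ⟨γ, v, h0, hd, hv, hO⟩ := h
  have hks := hk.symm
  have hd1 : HasFDerivAt k (fderiv ℝ k 0) 0 :=
    (hk.contDiffAt.self_of_nhds.differentiableAt (by simp)).hasFDerivAt
  have hd2 : HasFDerivAt k.symm (fderiv ℝ k.symm 0) 0 :=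
    (hks.contDiffAt.self_of_nhds.differentiableAt (by simp)).hasFDerivAt
  have hγ : Tendsto γ (𝓝 0) (𝓝 0) := by
    have := hd.continuousAt.tendsto
    rwa [h0] at this
  have hδ : Tendsto (fun t => k.symm (γ t)) (𝓝 0) (𝓝 0) := hks.tendsto.comp hγ
  refine ⟨fun t => k.symm (γ t), fderiv ℝ k.symm 0 v, ?_, ?_, ?_, ?_⟩
  · change k.symm (γ 0) = 0
    rw [h0]
    exact hks.map_zero
  · exact HasFDerivAt.comp_hasDerivAt (0 : ℝ) (by rwa [h0]) hd
  · intro hz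
    have h1 : HasFDerivAt (fun y => k (k.symm y)) ((fderiv ℝ k 0).comp (fderiv ℝ k.symm 0)) 0 :=
      HasFDerivAt.comp (0 : Space n) (by rwa [hks.map_zero]) hd2
    have h2 : HasFDerivAt (fun y => k (k.symm y)) (ContinuousLinearMap.id ℝ (Space n)) 0 := by
      refine (hasFDerivAt_id (0 : Space n)).congr_of_eventuallyEq ?_
      filter_upwards [k.open_target.mem_nhds hks.mem_source] with y hy
      exact k.right_inv hy
    have h3 := congrArg (fun L : Space n →L[ℝ] Space n => L v) (h1.unique h2)
    simp only [ContinuousLinearMap.comp_apply, hz, map_zero, ContinuousLinearMap.id_apply] at h3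
    exact hv h3.symm
  · have h1 : ∀ᶠ x in 𝓝 (0 : Space n), fderiv ℝ f x = (fderiv ℝ g (k x)).comp (fderiv ℝ k x) := by
      filter_upwards [hf.eventually_nhds, hk.contDiffAt] with x hx hkx
      have h2 : f =ᶠ[𝓝 x] fun x => g (k x) := hx
      rw [h2.fderiv_eq]
      exact fderiv_comp x (hg _) (hkx.differentiableAt (by simp))
    have h2 : (fun x => fderiv ℝ k x) =O[𝓝 0] fun _ => (1 : ℝ) :=
      ((hk.contDiffAt.self_of_nhds.fderiv_right (m := 0) (by simp)).continuousAt).isBigO_one ℝ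
    have h3 : (fun t => (fderiv ℝ g (γ t)).comp (fderiv ℝ k (k.symm (γ t)))) =O[𝓝 0]
        fun t => t ^ m * (1 : ℝ) := by
      refine IsBigO.trans (IsBigO.of_bound 1 (Eventually.of_forall fun t => ?_))
        (hO.norm_left.mul (h2.comp_tendsto hδ).norm_left)
      rw [one_mul, norm_mul, norm_norm, norm_norm]
      exact ContinuousLinearMap.opNorm_comp_le _ _
    simp only [mul_one] at h3
    refine h3.congr' ?_ EventuallyEq.rfl
    filter_upwards [hδ.eventually h1, hγ.eventually (k.open_target.mem_nhds hks.mem_source)]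
      with t h4 h5
    rw [h4, k.right_inv h5]

section NormalForm

variable {c b : ℝ} {d : ℕ} {Q : QuadraticForm ℝ (Fin n → ℝ)}

theorem hasFDerivAt_normalForm (c b : ℝ) (d : ℕ) (Q : QuadraticForm ℝ (Fin n → ℝ)) (x : Space n) :
    ∃ L : Space n →L[ℝ] ℝ, HasFDerivAt (normalForm c b d Q) L x ∧
      ∀ w, L w =
        b * (d * x 0 ^ (d - 1) * w 0) + QuadraticMap.polar Q (Fin.tail x) (Fin.tail w) := by
  let P : (Fin n → ℝ) →L[ℝ] (Fin n → ℝ) →L[ℝ] ℝ :=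
    LinearMap.toContinuousBilinearMap (QuadraticMap.polarBilin Q)
  have hP : ∀ v w, P v w = QuadraticMap.polar Q v w := fun v w => rfl
  let T : Space n →L[ℝ] (Fin n → ℝ) :=
    (ContinuousLinearMap.snd ℝ ℝ (Fin n → ℝ)).comp ((consL n).symm : Space n →L[ℝ] _)
  have hT : ∀ x, T x = Fin.tail x := fun x => rfl
  have hQ : ∀ v, Q v = 1 / 2 * P v v := fun v => by
    rw [hP, QuadraticMap.polar_self]
    simp
  have h1 : HasFDerivAt (fun x : Space n => x 0 ^ d)
      ((d * x 0 ^ (d - 1)) • (ContinuousLinearMap.proj 0 : Space n →L[ℝ] ℝ)) x :=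
    (hasDerivAt_pow d (x 0)).comp_hasFDerivAt x (hasFDerivAt_apply 0 x)
  have h3 := ((P.comp T).hasFDerivAt (x := x)).clm_apply (T.hasFDerivAt (x := x))
  have h2 := (h3.const_mul (1 / 2)).congr_of_eventuallyEq (f₁ := fun x : Space n => Q (Fin.tail x))
    (Eventually.of_forall fun x => hQ _)
  refine ⟨_, ((h1.const_mul b).const_add c).add h2, fun w => ?_⟩
  have h5 : P (T w) (T x) = P (T x) (T w) := by
    rw [hP, hP, QuadraticMap.polar_comm]
  simp [h5, ← hT, ← hP]
  ring

theorem differentiable_normalForm : Differentiable ℝ (normalForm c b d Q) := fun x => by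
  obtain ⟨L, hL, -⟩ := hasFDerivAt_normalForm c b d Q x
  exact hL.differentiableAt

theorem fderiv_normalForm_apply (x w : Space n) :
    fderiv ℝ (normalForm c b d Q) x w =
      b * (d * x 0 ^ (d - 1) * w 0) + QuadraticMap.polar Q (Fin.tail x) (Fin.tail w) := by
  obtain ⟨L, hL, h⟩ := hasFDerivAt_normalForm c b d Q x
  rw [hL.fderiv, h]

theorem hasCriticalCurve_normalForm (c b : ℝ) (m : ℕ) (Q : QuadraticForm ℝ (Fin n → ℝ)) :
    HasCriticalCurve m (normalForm c b (m + 1) Q) := by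
  have h1 : ∀ t : ℝ, fderiv ℝ (normalForm c b (m + 1) Q) (Pi.single 0 t) =
      (t ^ m) • ((b * (m + 1)) • (ContinuousLinearMap.proj 0 : Space n →L[ℝ] ℝ)) := fun t => by
    ext w
    rw [fderiv_normalForm_apply]
    have h2 : Fin.tail (Pi.single 0 t : Space n) = 0 := by
      ext i
      simp [Fin.tail]
    rw [h2, QuadraticMap.polar_zero_left]
    simp
    ring
  refine ⟨fun t => Pi.single 0 t, Pi.single 0 1, by simp, ?_, by simp, ?_⟩
  · have h2 := (hasDerivAt_id (0 : ℝ)).smul_const (Pi.single 0 1 : Space n)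
    have h3 : (fun t : ℝ => (Pi.single 0 t : Space n)) = fun t => t • Pi.single 0 1 :=
      funext fun t => by rw [← Pi.single_smul, smul_eq_mul, mul_one]
    rw [h3]
    simpa using! h2
  · simp only [h1]
    refine IsBigO.of_bound ‖((b * (m + 1)) • (ContinuousLinearMap.proj 0 : Space n →L[ℝ] ℝ))‖
      (Eventually.of_forall fun t => ?_)
    rw [norm_smul, mul_comm]

theorem deriv_eq_zero_of_isBigO {u : ℝ → ℝ} {u' : ℝ} (hu : HasDerivAt u u' 0) {m : ℕ} (hm : 2 ≤ m)
    (hO : u =O[𝓝 0] fun t => t ^ m) : u' = 0 := by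
  have h1 : u =o[𝓝 0] fun t : ℝ => t := by
    refine (hO.trans (isBigO_pow_of_le hm)).trans_isLittleO ?_
    simpa using isLittleO_pow_pow (𝕜 := ℝ) (show 1 < 2 by norm_num)
  have h0 : u 0 = 0 := hO.eq_zero_imp.self_of_nhds (zero_pow (by omega))
  have h2 : HasDerivAt u 0 0 := by
    rw [hasDerivAt_iff_isLittleO]
    simpa [h0] using h1
  exact hu.unique h2

/-- Along a curve with `df = O(t ^ (m + 1))` the first coordinate satisfies
`γ₀ ^ m = O(t ^ (m + 1))`, so its velocity vanishes, and the other velocities vanish because `Q` is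
nondegenerate. -/
theorem not_hasCriticalCurve_normalForm (hQ : NondegenerateForm Q) (hb : b ≠ 0) {m : ℕ}
    (hm : 1 ≤ m) : ¬ HasCriticalCurve (m + 1) (normalForm c b (m + 1) Q) := by
  rintro ⟨γ, v, h0, hd, hv, hO⟩
  have hw : ∀ w : Space n, (fun t => fderiv ℝ (normalForm c b (m + 1) Q) (γ t) w) =O[𝓝 0]
      fun t => t ^ (m + 1) := fun w => by
    refine IsBigO.trans (IsBigO.of_bound ‖w‖ (Eventually.of_forall fun t => ?_)) hO
    rw [mul_comm]
    exact ContinuousLinearMap.le_opNorm _ _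
  simp only [fderiv_normalForm_apply] at hw
  have hcoord := hasDerivAt_pi.1 hd
  apply hv
  have hv0 : v 0 = 0 := by
    have h1 := hw (Pi.single 0 1)
    have h2 : Fin.tail (Pi.single 0 1 : Space n) = 0 := by
      ext i
      simp [Fin.tail]
    simp only [h2, QuadraticMap.polar_zero_right, add_zero, Pi.single_eq_same, mul_one,
      Nat.add_sub_cancel] at h1
    have h3 : (fun t => (γ t 0) ^ m) =O[𝓝 0] fun t => t ^ (m + 1) := by
      have hc : b * ((m + 1 : ℕ) : ℝ) ≠ 0 := mul_ne_zero hb (by positivity)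
      simp only [← mul_assoc] at h1
      exact (isBigO_const_mul_left_iff hc).1 h1
    have h4 : Tendsto (fun t : ℝ => t⁻¹ * γ t 0) (𝓝[≠] 0) (𝓝 (v 0)) := by
      have := hasDerivAt_iff_tendsto_slope_zero.1 (hcoord 0)
      simpa [h0] using this
    have h5 : Tendsto (fun t : ℝ => (t⁻¹ * γ t 0) ^ m) (𝓝[≠] 0) (𝓝 0) := by
      have h6 : (fun t : ℝ => (t⁻¹ * γ t 0) ^ m) =O[𝓝[≠] 0] fun t => t := by
        have h7 := (isBigO_refl (fun t : ℝ => (t⁻¹) ^ m) (𝓝[≠] 0)).mul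
          (h3.mono nhdsWithin_le_nhds)
        refine (h7.congr_left fun t => (mul_pow _ _ _).symm).congr' EventuallyEq.rfl ?_
        filter_upwards [self_mem_nhdsWithin] with t ht
        have : t ≠ 0 := ht
        rw [pow_succ, ← mul_assoc, ← mul_pow, inv_mul_cancel₀ this, one_pow, one_mul]
      exact h6.trans_tendsto (tendsto_id.mono_left nhdsWithin_le_nhds)
    have h6 := tendsto_nhds_unique (h4.pow m) h5
    exact pow_eq_zero_iff (by omega) |>.1 h6
  have hvt : Fin.tail v = 0 := by
    apply hQ
    intro w
    have h1 := hw (Fin.cons 0 w)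
    simp only [Fin.cons_zero, mul_zero, zero_add, Fin.tail_cons] at h1
    let P : (Fin n → ℝ) →L[ℝ] ℝ :=
      (LinearMap.toContinuousBilinearMap (QuadraticMap.polarBilin Q)).flip w
    have h2 : HasDerivAt (fun t => P (Fin.tail (γ t))) (P (Fin.tail v)) 0 :=
      P.hasFDerivAt.comp_hasDerivAt (0 : ℝ)
        (hasDerivAt_pi.2 fun i => hcoord i.succ : HasDerivAt (fun t => Fin.tail (γ t)) _ 0)
    exact deriv_eq_zero_of_isBigO h2 (by omega : 2 ≤ m + 1) h1
  ext i
  refine Fin.cases hv0 (fun i => ?_) i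
  exact congrFun hvt i

end NormalForm

/-- The curve `(y, Z(y))` is critical to the order to which the derivative `f_y(y, Z(y))` of the
critical value vanishes. -/
theorem IsAdmissible.hasCriticalCurve (h : IsAdmissible f Z) {m : ℕ}
    (hm : ∀ j, 2 ≤ j → j < m → critSeq f Z j = 0) : HasCriticalCurve m f := by
  refine ⟨fun y => Fin.cons y (Z y), Pi.single 0 1, ?_, ?_, by simp, ?_⟩
  · change (Fin.cons 0 (Z 0) : Space n) = 0
    rw [h.curve.zero, ← consL_apply]
    exact map_zero _
  · have h1 := (consL n).hasFDerivAt.comp_hasDerivAt (0 : ℝ)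
      ((hasDerivAt_id (0 : ℝ)).prodMk h.curve.deriv_zero)
    rwa [ContinuousLinearEquiv.coe_coe, consL_one] at h1
  · have hs := h.contDiff_alongCurve (contDiff_partialD h.smooth [0])
    obtain ⟨G, hG, hGe, -⟩ := exists_eq_pow_mul hs m fun j hj => by
      rw [← h.iteratedDeriv_succ_alongCurve]
      match j with
      | 0 => exact h.iteratedDeriv_one_eq_zero
      | 1 => exact h.iteratedDeriv_two_eq_zero
      | j + 2 => exact hm (j + 2) (by omega) hj
    have h1 : ∀ᶠ y in 𝓝 (0 : ℝ), fderiv ℝ f (Fin.cons y (Z y)) =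
        y ^ m • (G y • (ContinuousLinearMap.proj 0 : Space n →L[ℝ] ℝ)) := by
      filter_upwards [h.curve.crit] with y hy
      ext x
      rw [clm_apply_eq_sum, Fin.sum_univ_succ, Finset.sum_eq_zero, add_zero]
      · change x 0 * alongCurve Z (partialD [0] f) y = _
        rw [hGe]
        simp
        ring
      · intro i _
        have := dz_comp_consL_single (f := f) (y, Z y) i
        rw [hy] at this
        have h3 : fderiv ℝ f (Fin.cons y (Z y)) (Pi.single i.succ 1) = 0 := this.symm
        rw [h3, mul_zero]
    have h2 : (fun y => G y • (ContinuousLinearMap.proj 0 : Space n →L[ℝ] ℝ)) =O[𝓝 0]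
        fun _ => (1 : ℝ) :=
      (hG.continuous.smul continuous_const).continuousAt.isBigO_one ℝ
    have h3 := (isBigO_refl (fun t : ℝ => t ^ m) (𝓝 0)).smul h2
    simp only [smul_eq_mul, mul_one] at h3
    exact h3.congr' (h1.mono fun _ h => h.symm) EventuallyEq.rfl

theorem REquivalent.hasCriticalCurve_iff {g : Space n → ℝ} (hf : Differentiable ℝ f)
    (hg : Differentiable ℝ g) (h : REquivalent f g) (m : ℕ) :
    HasCriticalCurve m f ↔ HasCriticalCurve m g := by
  obtain ⟨k, hk, he⟩ := h
  refine ⟨fun h1 => h1.comp hf hk.symm (he.mono fun _ h => h.symm), fun h1 => h1.comp hg hk ?_⟩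
  filter_upwards [hk.tendsto.eventually he, k.open_source.mem_nhds hk.mem_source] with x h2 h3
  rw [← h2, k.left_inv h3]

/-- The type `A_m` is read off from the derivatives of the critical value: a normal form has
critical curves of order `m` but not of order `m + 1`. -/
theorem IsAdmissible.firstNonzeroAt_of_reducesTo (h : IsAdmissible f Z) {m : ℕ} (hm : 2 ≤ m) {b : ℝ}
    (hb : b ≠ 0) (hr : ReducesTo f b (m + 1)) : FirstNonzeroAt (critSeq f Z) m := by
  have hf : Differentiable ℝ f := h.smooth.differentiable (by simp)
  obtain ⟨c, Q, hQ, hR⟩ := hr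
  have hm1 : HasCriticalCurve m f := (hR.hasCriticalCurve_iff hf differentiable_normalForm m).2
    (hasCriticalCurve_normalForm c b m Q)
  have hm2 : ¬ HasCriticalCurve (m + 1) f := fun h1 =>
    not_hasCriticalCurve_normalForm hQ hb (by omega)
      ((hR.hasCriticalCurve_iff hf differentiable_normalForm (m + 1)).1 h1)
  have hlt : ∀ j, 2 ≤ j → j < m → critSeq f Z j = 0 := by
    intro j
    induction j using Nat.strong_induction_on with
    | _ j ih =>
      intro h2 hjm
      by_contra hne
      -- At the first nonzero `a_j` the function has type `A_j`, which excludes order `j + 1 ≤ m`.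
      obtain ⟨c', Q', hQ', hR'⟩ := h.reducesTo (m := j)
        (fun i h3 h4 => ih i h4 h3 (h4.trans hjm)) (b := critSeq f Z j) (by
          rw [div_self hne]; exact one_pos)
      exact not_hasCriticalCurve_normalForm hQ' hne (by omega)
        ((hR'.hasCriticalCurve_iff hf differentiable_normalForm (j + 1)).1 (hm1.mono hjm))
  refine ⟨hlt, fun h0 => hm2 (h.hasCriticalCurve fun j h3 h4 => ?_)⟩
  rcases Nat.lt_succ_iff_lt_or_eq.1 h4 with h5 | rfl
  · exact hlt j h3 h5
  · exact h0

end Types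

/-! ### Correction polynomials -/

section JetPolynomials

variable {n : ℕ}

/-- A number assigned to admissible pairs `(f, Z)` is given by an integer polynomial, without free
term, in the indeterminates allowed in the correction term of `a_m`. -/
def IsJetPoly (m : ℕ) (Φ : (Space n → ℝ) → (ℝ → Fin n → ℝ) → ℝ) : Prop :=
  ∃ p : MvPolynomial (JetVar n) ℤ, (∀ x ∈ p.vars, x.Allowed m) ∧
    MvPolynomial.constantCoeff p = 0 ∧
    ∀ f Z, IsAdmissible f Z → Φ f Z = MvPolynomial.aeval (JetVar.value f) p

variable {m : ℕ} {Φ Ψ : (Space n → ℝ) → (ℝ → Fin n → ℝ) → ℝ}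

theorem JetVar.Allowed.mono {m k : ℕ} (hmk : m ≤ k) {x : JetVar n} (h : x.Allowed m) :
    x.Allowed k := by
  cases x with
  | deriv w => exact ⟨h.1, h.2.1.trans hmk, h.2.2⟩
  | inv i j => trivial

theorem IsJetPoly.mono {k : ℕ} (hmk : m ≤ k) (h : IsJetPoly m Φ) : IsJetPoly k Φ := by
  obtain ⟨p, h1, h2, h3⟩ := h
  exact ⟨p, fun x hx => (h1 x hx).mono hmk, h2, h3⟩

theorem IsJetPoly.congr (h : IsJetPoly m Φ) (he : ∀ f Z, IsAdmissible f Z → Ψ f Z = Φ f Z) :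
    IsJetPoly m Ψ := by
  obtain ⟨p, h1, h2, h3⟩ := h
  exact ⟨p, h1, h2, fun f Z hfZ => (he f Z hfZ).trans (h3 f Z hfZ)⟩

theorem isJetPoly_zero (m : ℕ) : IsJetPoly (n := n) m fun _ _ => 0 :=
  ⟨0, by simp, by simp, by simp⟩

theorem IsJetPoly.add (hΦ : IsJetPoly m Φ) (hΨ : IsJetPoly m Ψ) :
    IsJetPoly m fun f Z => Φ f Z + Ψ f Z := by
  classical
  obtain ⟨p, h1, h2, h3⟩ := hΦ
  obtain ⟨q, k1, k2, k3⟩ := hΨ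
  refine ⟨p + q, fun x hx => ?_, by simp [h2, k2], fun f Z h => by simp [h3 f Z h, k3 f Z h]⟩
  rcases Finset.mem_union.1 (MvPolynomial.vars_add_subset p q hx) with hx | hx
  · exact h1 x hx
  · exact k1 x hx

theorem IsJetPoly.mul (hΦ : IsJetPoly m Φ) (hΨ : IsJetPoly m Ψ) :
    IsJetPoly m fun f Z => Φ f Z * Ψ f Z := by
  classical
  obtain ⟨p, h1, h2, h3⟩ := hΦ
  obtain ⟨q, k1, k2, k3⟩ := hΨ
  refine ⟨p * q, fun x hx => ?_, by simp [h2], fun f Z h => by simp [h3 f Z h, k3 f Z h]⟩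
  rcases Finset.mem_union.1 (MvPolynomial.vars_mul p q hx) with hx | hx
  · exact h1 x hx
  · exact k1 x hx

theorem IsJetPoly.intCast_mul (c : ℤ) (hΦ : IsJetPoly m Φ) :
    IsJetPoly m fun f Z => c * Φ f Z := by
  classical
  obtain ⟨p, h1, h2, h3⟩ := hΦ
  refine ⟨MvPolynomial.C c * p, fun x hx => ?_, by simp [h2], fun f Z h => by simp [h3 f Z h]⟩
  rcases Finset.mem_union.1 (MvPolynomial.vars_mul _ _ hx) with hx | hx
  · rw [MvPolynomial.vars_C] at hx
    simp at hx
  · exact h1 x hx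

theorem IsJetPoly.sum {ι : Type} (s : Finset ι)
    {Φ : ι → (Space n → ℝ) → (ℝ → Fin n → ℝ) → ℝ} (h : ∀ i ∈ s, IsJetPoly m (Φ i)) :
    IsJetPoly m fun f Z => ∑ i ∈ s, Φ i f Z := by
  classical
  induction s using Finset.induction_on with
  | empty => simpa using isJetPoly_zero m
  | insert i s hi ih =>
    simp only [Finset.sum_insert hi]
    exact (h i (Finset.mem_insert_self i s)).add
      (ih fun j hj => h j (Finset.mem_insert_of_mem hj))

theorem isJetPoly_var {x : JetVar n} (hx : x.Allowed m) :
    IsJetPoly m fun f _ => x.value f :=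
  ⟨MvPolynomial.X x, fun y hy => by
    rw [MvPolynomial.vars_X, Finset.mem_singleton] at hy
    rwa [hy], by simp, by simp⟩

theorem iteratedDeriv_sum {ι : Type} (s : Finset ι) {F : ι → ℝ → ℝ} {j : ℕ} {x : ℝ}
    (h : ∀ i ∈ s, ContDiff ℝ ∞ (F i)) :
    iteratedDeriv j (fun y => ∑ i ∈ s, F i y) x = ∑ i ∈ s, iteratedDeriv j (F i) x := by
  classical
  induction s using Finset.induction_on with
  | empty => simp
  | insert i s hi ih =>
    simp only [Finset.sum_insert hi]
    have h1 : ContDiff ℝ ∞ (F i) := h i (Finset.mem_insert_self i s)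
    have h2 : ContDiff ℝ ∞ fun y => ∑ i ∈ s, F i y :=
      ContDiff.sum fun k hk => h k (Finset.mem_insert_of_mem hk)
    rw [iteratedDeriv_fun_add (h1.of_le (by exact_mod_cast le_top)).contDiffAt
      (h2.of_le (by exact_mod_cast le_top)).contDiffAt,
      ih fun k hk => h k (Finset.mem_insert_of_mem hk)]

/-- The derivative of order `j` at the origin of the restriction of a partial derivative of `f`
to the critical curve. -/
noncomputable def curveD (j : ℕ) (w : List (Fin (n + 1))) (f : Space n → ℝ)
    (Z : ℝ → Fin n → ℝ) : ℝ := iteratedDeriv j (alongCurve Z (partialD w f)) 0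

/-- The derivative of order `j` at the origin of a component of `Z`. -/
noncomputable def compD (j : ℕ) (i : Fin n) (_ : Space n → ℝ) (Z : ℝ → Fin n → ℝ) : ℝ :=
  iteratedDeriv j (fun y => Z y i) 0

theorem IsAdmissible.curveD_succ {f : Space n → ℝ} {Z : ℝ → Fin n → ℝ} (h : IsAdmissible f Z)
    (j : ℕ) (w : List (Fin (n + 1))) :
    curveD (j + 1) w f Z = curveD j (0 :: w) f Z + ∑ i : Fin n, ∑ k ∈ Finset.range (j + 1),
      (j.choose k : ℝ) * compD (k + 1) i f Z * curveD (j - k) (i.succ :: w) f Z := by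
  have hs : ∀ w, ContDiff ℝ ∞ (alongCurve Z (partialD w f)) := fun w =>
    h.contDiff_alongCurve (contDiff_partialD h.smooth w)
  have hZ : ∀ i, ContDiff ℝ ∞ fun y => Z y i := fun i => contDiff_pi.1 h.curve.smooth i
  have hZ' : ∀ i, ContDiff ℝ ∞ (deriv fun y => Z y i) := fun i => (hZ i).deriv'
  have hle : (j : WithTop ℕ∞) ≤ ∞ := by exact_mod_cast le_top
  rw [curveD, iteratedDeriv_succ', funext fun y => (h.hasDerivAt_alongCurve w y).deriv,
    iteratedDeriv_fun_add ((hs _).of_le hle).contDiffAt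
      ((ContDiff.sum fun i _ => (hZ' i).mul (hs _)).of_le hle).contDiffAt,
    iteratedDeriv_sum _ fun i _ => (hZ' i).mul (hs _)]
  congr 1
  refine Finset.sum_congr rfl fun i _ => ?_
  rw [iteratedDeriv_fun_mul ((hZ' i).of_le hle).contDiffAt ((hs _).of_le hle).contDiffAt]
  refine Finset.sum_congr rfl fun k _ => ?_
  rw [compD, iteratedDeriv_succ']
  rfl

theorem IsAdmissible.compD_one {f : Space n → ℝ} {Z : ℝ → Fin n → ℝ} (h : IsAdmissible f Z)
    (i : Fin n) : compD 1 i f Z = 0 := by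
  rw [compD, iteratedDeriv_one]
  exact h.deriv_Z_zero i

theorem IsAdmissible.curveD_zero {f : Space n → ℝ} {Z : ℝ → Fin n → ℝ} (h : IsAdmissible f Z)
    (w : List (Fin (n + 1))) : curveD 0 w f Z = partialD w f 0 := by
  rw [curveD, iteratedDeriv_zero, h.alongCurve_zero]

theorem IsAdmissible.isUnit_dyzz {f : Space n → ℝ} {Z : ℝ → Fin n → ℝ} (h : IsAdmissible f Z) :
    IsUnit (dyzz f 0) := by
  rw [← Matrix.vecMul_injective_iff_isUnit]
  refine (injective_iff_map_eq_zero (Matrix.vecMulLinear (dyzz f 0))).2 fun v hv => ?_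
  apply eq_zero_of_dzz_comp_consL h.smooth h.ker
  ext1 w
  have h1 : ∀ j, dzz (f ∘ consL n) 0 v (Pi.single j 1) = 0 := fun j => by
    have h2 : dzz (f ∘ consL n) 0 v (Pi.single j 1) =
        (dzz (f ∘ consL n) 0).flip (Pi.single j 1) v := rfl
    rw [h2, clm_apply_eq_sum]
    have h3 := congrFun hv j
    simp only [Matrix.vecMulLinear_apply, Matrix.vecMul, dotProduct, Pi.zero_apply] at h3
    rw [← h3]
    refine Finset.sum_congr rfl fun i _ => ?_
    rw [ContinuousLinearMap.flip_apply, dzz_comp_consL_single h.smooth, map_zero]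
    rfl
  rw [clm_apply_eq_sum]
  simp [h1]

/-- The order count: each differentiation along the curve raises by one the order of the partial
derivatives of `f` involved, and the derivatives of `Z` up to order `j` cost order at most `j + 1`.
The term with `Z'(0) = 0` drops out. -/
theorem isJetPoly_curveD (j : ℕ)
    (hZ : ∀ k, 2 ≤ k → k ≤ j → ∀ i : Fin n, IsJetPoly (k + 1) (compD k i))
    (w : List (Fin (n + 1))) (hw : ∃ i ∈ w, i ≠ 0) (h2 : 2 ≤ w.length) (h3 : 3 ≤ w.length + j) :
    IsJetPoly (w.length + j) (curveD j w) := by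
  induction j using Nat.strong_induction_on generalizing w with
  | _ j ih =>
    match j with
    | 0 =>
      exact (isJetPoly_var (x := JetVar.deriv w) ⟨h3, le_rfl, hw⟩).congr
        fun f Z h => h.curveD_zero w
    | j + 1 =>
      refine IsJetPoly.congr (IsJetPoly.add ?_ (IsJetPoly.sum _ fun i _ =>
        IsJetPoly.sum _ fun k hk => ?_)) fun f Z h => h.curveD_succ j w
      · obtain ⟨i, hi, hi0⟩ := hw
        have := ih j (by omega) (fun k hk hkj => hZ k hk (by omega)) (0 :: w)
          ⟨i, List.mem_cons_of_mem _ hi, hi0⟩ (by simp; omega) (by simp; omega)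
        exact this.mono (by simp; omega)
      · have hkj : k ≤ j := by have := Finset.mem_range.1 hk; omega
        rcases Nat.eq_zero_or_pos k with rfl | hk0
        · exact (isJetPoly_zero _).congr fun f Z h => by rw [h.compD_one]; simp
        · have h4 := (hZ (k + 1) (by omega) (by omega) i).mono
            (show k + 1 + 1 ≤ w.length + (j + 1) by omega)
          have h5 := (ih (j - k) (by omega) (fun l hl hlj => hZ l hl (by omega)) (i.succ :: w)
            ⟨i.succ, List.mem_cons_self, Fin.succ_ne_zero i⟩ (by simp; omega)
            (by simp; omega)).mono
            (show (i.succ :: w).length + (j - k) ≤ w.length + (j + 1) by simp; omega)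
          exact ((h4.intCast_mul (j.choose k)).mul h5).congr fun f Z _ => by simp

/-- The Taylor coefficients of `Z` are integer polynomials in the partial derivatives of `f` and in
the components of `f_{z^2}⁻¹`: differentiating `f_z(y, Z(y)) = 0` gives a linear system for the
derivative of highest order, whose matrix is `f_{z^2}`. -/
theorem isJetPoly_compD (j : ℕ) (hj : 2 ≤ j) (i : Fin n) : IsJetPoly (j + 1) (compD j i) := by
  induction j using Nat.strong_induction_on generalizing i with
  | _ j ih =>
    obtain ⟨j, rfl⟩ : ∃ j', j = j' + 1 := ⟨j - 1, by omega⟩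
    let R : Fin n → (Space n → ℝ) → (ℝ → Fin n → ℝ) → ℝ := fun l f Z =>
      curveD j [0, l.succ] f Z + ∑ i : Fin n, ∑ k ∈ Finset.range j,
        (j.choose k : ℝ) * compD (k + 1) i f Z * curveD (j - k) [i.succ, l.succ] f Z
    have hR : ∀ l, IsJetPoly (j + 1 + 1) (R l) := fun l => by
      refine IsJetPoly.add ?_ (IsJetPoly.sum _ fun i _ => IsJetPoly.sum _ fun k hk => ?_)
      · exact (isJetPoly_curveD j (fun k hk hkj i => ih k (by omega) hk i) [0, l.succ]
          ⟨l.succ, by simp, Fin.succ_ne_zero l⟩ (by simp) (by simp; omega)).mono (by simp; omega)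
      · have hkj := Finset.mem_range.1 hk
        rcases Nat.eq_zero_or_pos k with rfl | hk0
        · exact (isJetPoly_zero _).congr fun f Z h => by rw [h.compD_one]; simp
        · have h4 := (ih (k + 1) (by omega) (by omega) i).mono
            (show k + 1 + 1 ≤ j + 1 + 1 by omega)
          have h5 := (isJetPoly_curveD (j - k) (fun l hl hlj i => ih l (by omega) hl i)
            [i.succ, l.succ] ⟨i.succ, by simp, Fin.succ_ne_zero i⟩ (by simp)
            (by simp; omega)).mono (show 2 + (j - k) ≤ j + 1 + 1 by omega)
          exact ((h4.intCast_mul (j.choose k)).mul h5).congr fun f Z _ => by simp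
    have key : ∀ f Z, IsAdmissible f Z →
        compD (j + 1) i f Z = ((-1 : ℤ) : ℝ) * ∑ l, R l f Z * invHess f l i := by
      intro f Z h
      have h1 : Matrix.vecMul (fun i => compD (j + 1) i f Z) (dyzz f 0) = fun l => -R l f Z := by
        ext l
        have h2 : curveD (j + 1) [l.succ] f Z = 0 := by
          have h3 : alongCurve Z (partialD [l.succ] f) =ᶠ[𝓝 0] fun _ => 0 :=
            h.alongCurve_succ_eventually l
          rw [curveD, h3.iteratedDeriv_eq]
          simp
        rw [h.curveD_succ] at h2
        simp only [Finset.sum_range_succ, Finset.sum_add_distrib, Nat.choose_self, Nat.cast_one,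
          one_mul, Nat.sub_self, h.curveD_zero] at h2
        have h4 : Matrix.vecMul (fun i => compD (j + 1) i f Z) (dyzz f 0) l =
          ∑ i : Fin n, compD (j + 1) i f Z * partialD [i.succ, l.succ] f 0 := rfl
        rw [h4]
        simp only [R]
        linarith
      have h5 := congrArg (fun v => Matrix.vecMul v (invHess f)) h1
      simp only [Matrix.vecMul_vecMul] at h5
      rw [invHess, Matrix.mul_nonsing_inv _ ((Matrix.isUnit_iff_isUnit_det _).1 h.isUnit_dyzz),
        Matrix.vecMul_one] at h5
      have h6 := congrFun h5 i
      simp only [Matrix.vecMul, dotProduct] at h6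
      rw [h6]
      simp [invHess]
    refine IsJetPoly.congr (IsJetPoly.intCast_mul (-1) (IsJetPoly.sum _ fun l _ =>
      (hR l).mul (isJetPoly_var (x := JetVar.inv l i) trivial))) key

/-- The derivatives of the critical value: the only term of the highest order is the pure
derivative, since `Z'(0) = 0` and `f_{yz} = 0`. -/
theorem isJetPoly_curveD_replicate (j a : ℕ) (ha : 1 ≤ a) (h3 : 3 ≤ a + j) :
    IsJetPoly (n := n) (a + j - 1) fun f Z =>
      curveD j (List.replicate a 0) f Z - partialD (List.replicate (a + j) 0) f 0 := by
  induction j generalizing a with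
  | zero => exact (isJetPoly_zero _).congr fun f Z h => by rw [h.curveD_zero]; simp
  | succ j ih =>
    have h1 := ih (a + 1) (by omega) (by omega)
    have hcongr := fun (f : Space n → ℝ) Z (h : IsAdmissible f Z) =>
      h.curveD_succ j (List.replicate a 0)
    refine IsJetPoly.congr (IsJetPoly.add (h1.mono (by omega)) (IsJetPoly.sum Finset.univ
      (Φ := fun i f Z => ∑ k ∈ Finset.range (j + 1), (j.choose k : ℝ) * compD (k + 1) i f Z *
        curveD (j - k) (i.succ :: List.replicate a 0) f Z) fun i _ =>
        IsJetPoly.sum _ fun k hk => ?_)) fun f Z h => ?_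
    · have hkj : k ≤ j := by have := Finset.mem_range.1 hk; omega
      rcases Nat.eq_zero_or_pos k with rfl | hk0
      · exact (isJetPoly_zero _).congr fun f Z h => by rw [h.compD_one]; simp
      · by_cases hak : a = 1 ∧ k = j
        · obtain ⟨rfl, rfl⟩ := hak
          refine (isJetPoly_zero _).congr fun f Z h => ?_
          have h6 : curveD (k - k) (i.succ :: List.replicate 1 0) f Z = 0 := by
            rw [Nat.sub_self, h.curveD_zero]
            exact partialD_cons_zero h.smooth h.ker _
          rw [h6, mul_zero]
        · have h4 := (isJetPoly_compD (k + 1) (by omega) i).mono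
            (show k + 1 + 1 ≤ a + (j + 1) - 1 by omega)
          have h5 := (isJetPoly_curveD (j - k) (fun l hl hlj i => isJetPoly_compD l hl i)
            (i.succ :: List.replicate a 0) ⟨i.succ, List.mem_cons_self, Fin.succ_ne_zero i⟩
            (by simp; omega) (by simp; omega)).mono
            (show _ ≤ a + (j + 1) - 1 by simp; omega)
          exact ((h4.intCast_mul (j.choose k)).mul h5).congr fun f Z _ => by simp
    · rw [h.curveD_succ, show a + (j + 1) = a + 1 + j by omega, List.replicate_succ]
      ring

/-- The numbers `a_m` as polynomials: `P m` is the correction in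
`φ^{(m+1)}(0) = ∂^{m+1}f(0)/∂y^{m+1} + P m`, where `φ` is the critical value. -/
theorem exists_correction (n : ℕ) : ∃ P : ℕ → MvPolynomial (JetVar n) ℤ, ∀ m, 2 ≤ m →
    (∀ x ∈ (P m).vars, x.Allowed m) ∧ MvPolynomial.constantCoeff (P m) = 0 ∧
    ∀ f Z, IsAdmissible f Z → aNum P f m = critSeq f Z m := by
  have h1 : ∀ m, ∃ p : MvPolynomial (JetVar n) ℤ, 2 ≤ m → (∀ x ∈ p.vars, x.Allowed m) ∧
      MvPolynomial.constantCoeff p = 0 ∧ ∀ f Z, IsAdmissible f Z →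
        critSeq f Z m - dy f (m + 1) = MvPolynomial.aeval (JetVar.value f) p := by
    intro m
    by_cases hm : 2 ≤ m
    · obtain ⟨p, h1, h2, h3⟩ := isJetPoly_curveD_replicate (n := n) m 1 le_rfl (by omega)
      rw [Nat.add_sub_cancel_left] at h1
      refine ⟨p, fun _ => ⟨h1, h2, fun f Z h => ?_⟩⟩
      rw [← h3 f Z h, critSeq, h.iteratedDeriv_succ_alongCurve, dy, add_comm m 1]
      rfl
    · exact ⟨0, fun h => absurd h hm⟩
  choose P hP using h1
  refine ⟨P, fun m hm => ⟨(hP m hm).1, (hP m hm).2.1, fun f Z h => ?_⟩⟩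
  rw [aNum, ← (hP m hm).2.2 f Z h]
  ring

end JetPolynomials

/-! ### Expansions in the transversal variables -/

section Expansion

variable {n : ℕ} {f : Space n → ℝ}

/-- The form of degree `k` in `ζ` whose coefficients are taken from a family `F` indexed by lists
of coordinates. -/
def zForm (F : List (Fin (n + 1)) → ℝ) : ℕ → List (Fin (n + 1)) → (Fin n → ℝ) → ℝ
  | 0, w, _ => F w
  | k + 1, w, ζ => ∑ i, ζ i * zForm F k (i.succ :: w) ζ

theorem zForm_smul (F : List (Fin (n + 1)) → ℝ) (k : ℕ) (w : List (Fin (n + 1))) (s : ℝ)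
    (ζ : Fin n → ℝ) : zForm F k w (s • ζ) = s ^ k * zForm F k w ζ := by
  induction k generalizing w with
  | zero => simp [zForm]
  | succ k ih =>
    simp only [zForm, ih, Finset.mul_sum, Pi.smul_apply, smul_eq_mul]
    exact Finset.sum_congr rfl fun i _ => by ring

/-- The restriction of the partial derivatives of `f` to the axis `z = 0`. -/
noncomputable def axisD (f : Space n → ℝ) (y : ℝ) (w : List (Fin (n + 1))) : ℝ :=
  partialD w f (Fin.cons y 0)

theorem hasDerivAt_partialD_cons (hf : ContDiff ℝ ∞ f) (w : List (Fin (n + 1))) (y : ℝ)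
    (ζ : Fin n → ℝ) (s : ℝ) :
    HasDerivAt (fun s : ℝ => partialD w f (Fin.cons y (s • ζ)))
      (∑ i, ζ i * partialD (i.succ :: w) f (Fin.cons y (s • ζ))) s := by
  have h1 : HasDerivAt (fun s : ℝ => (Fin.cons y (s • ζ) : Space n)) (Fin.cons 0 ζ) s := by
    rw [hasDerivAt_pi]
    intro i
    refine Fin.cases ?_ (fun i => ?_) i
    · simpa using! hasDerivAt_const s y
    · simpa using! (hasDerivAt_id s).mul_const (ζ i)
  have h2 := hasDerivAt_partialD_comp hf w h1
  rw [Fin.sum_univ_succ] at h2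
  simpa using h2

/-- Taylor's formula in the variable `z`, with a remainder which is uniform in `y`. -/
theorem exists_zForm_bound (hf : ContDiff ℝ ∞ f) (N : ℕ) (w : List (Fin (n + 1))) :
    ∃ C : ℝ, 0 ≤ C ∧ ∀ (y : ℝ) (ζ : Fin n → ℝ), |y| ≤ 1 → ‖ζ‖ ≤ 1 →
      |partialD w f (Fin.cons y ζ) -
        ∑ k ∈ Finset.range N, zForm (axisD f y) k w ζ / k.factorial| ≤ C * ‖ζ‖ ^ N := by
  induction N generalizing w with
  | zero =>
    have hK : IsCompact (Metric.closedBall (0 : ℝ × (Fin n → ℝ)) 1) := isCompact_closedBall _ _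
    have hc : Continuous fun p : ℝ × (Fin n → ℝ) => partialD w f (consL n p) :=
      (contDiff_partialD hf w).continuous.comp (consL n).continuous
    obtain ⟨C, hC⟩ := hK.exists_bound_of_continuousOn hc.continuousOn
    refine ⟨|C|, abs_nonneg C, fun y ζ hy hζ => ?_⟩
    have := hC (y, ζ) (by simpa [Prod.norm_def] using ⟨hy, hζ⟩)
    simpa using! this.trans (le_abs_self C)
  | succ N ih =>
    choose C hC0 hC using ih
    have hS0 : 0 ≤ ∑ i : Fin n, C (i.succ :: w) := Finset.sum_nonneg fun i _ => hC0 _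
    refine ⟨∑ i : Fin n, C (i.succ :: w), hS0, fun y ζ hy hζ => ?_⟩
    let r : ℝ → ℝ := fun s => partialD w f (Fin.cons y (s • ζ)) -
      ∑ k ∈ Finset.range (N + 1), s ^ k * zForm (axisD f y) k w ζ / k.factorial
    let r' : ℝ → ℝ := fun s => ∑ i, ζ i * (partialD (i.succ :: w) f (Fin.cons y (s • ζ)) -
      ∑ k ∈ Finset.range N, zForm (axisD f y) k (i.succ :: w) (s • ζ) / k.factorial)
    have hr : ∀ s, HasDerivAt r (r' s) s := fun s => by
      have h1 : HasDerivAt (fun s : ℝ => ∑ k ∈ Finset.range (N + 1),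
          s ^ k * zForm (axisD f y) k w ζ / k.factorial)
          (∑ k ∈ Finset.range N, s ^ k * zForm (axisD f y) (k + 1) w ζ / k.factorial) s := by
        have h2 : HasDerivAt (fun s : ℝ => ∑ k ∈ Finset.range (N + 1),
          s ^ k * zForm (axisD f y) k w ζ / k.factorial)
          (∑ k ∈ Finset.range (N + 1), k * s ^ (k - 1) * zForm (axisD f y) k w ζ / k.factorial)
            s :=
          HasDerivAt.fun_sum fun k _ => ((hasDerivAt_pow k s).mul_const _).div_const _
        refine h2.congr_deriv ?_
        rw [Finset.sum_range_succ']
        simp only [Nat.cast_zero, zero_mul, zero_div, add_zero, Nat.add_sub_cancel]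
        refine Finset.sum_congr rfl fun k _ => ?_
        rw [Nat.factorial_succ]
        push_cast
        field_simp
      refine ((hasDerivAt_partialD_cons hf w y ζ s).sub h1).congr_deriv ?_
      simp only [r', mul_sub, Finset.sum_sub_distrib]
      congr 1
      simp only [Finset.mul_sum]
      rw [Finset.sum_comm]
      refine Finset.sum_congr rfl fun k _ => ?_
      simp only [zForm, zForm_smul, Finset.mul_sum, Finset.sum_div]
      exact Finset.sum_congr rfl fun i _ => by ring
    have hb : ∀ s ∈ Icc (0 : ℝ) 1, ‖r' s‖ ≤ (∑ i : Fin n, C (i.succ :: w)) * ‖ζ‖ ^ (N + 1) := by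
      intro s hs
      have hsζ : ‖s • ζ‖ ≤ ‖ζ‖ := by
        rw [norm_smul, Real.norm_eq_abs, abs_of_nonneg hs.1]
        exact mul_le_of_le_one_left (norm_nonneg _) hs.2
      refine (norm_sum_le _ _).trans ?_
      rw [Finset.sum_mul]
      refine Finset.sum_le_sum fun i _ => ?_
      rw [norm_mul, pow_succ, mul_comm (‖ζ‖ ^ N), mul_left_comm]
      refine mul_le_mul (norm_le_pi_norm ζ i) ?_ (norm_nonneg _) (norm_nonneg _)
      refine (hC (i.succ :: w) y (s • ζ) hy (hsζ.trans hζ)).trans ?_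
      exact mul_le_mul_of_nonneg_left (pow_le_pow_left₀ (norm_nonneg _) hsζ N) (hC0 _)
    have h1 := (convex_Icc (0 : ℝ) 1).norm_image_sub_le_of_norm_hasDerivWithin_le
      (fun s _ => (hr s).hasDerivWithinAt) hb (left_mem_Icc.2 zero_le_one)
      (right_mem_Icc.2 zero_le_one)
    have h2 : r 0 = 0 := by
      simp only [r, Finset.sum_range_succ']
      simp [zForm, axisD]
    have h3 : r 1 = partialD w f (Fin.cons y ζ) -
        ∑ k ∈ Finset.range (N + 1), zForm (axisD f y) k w ζ / k.factorial := by
      simp [r]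
    rw [h2, h3] at h1
    simpa using h1

theorem hasDerivAt_axisD (hf : ContDiff ℝ ∞ f) (w : List (Fin (n + 1))) (y : ℝ) :
    HasDerivAt (fun y => axisD f y w) (axisD f y (0 :: w)) y := by
  have h1 : HasDerivAt (fun y : ℝ => (Fin.cons y 0 : Space n)) (Pi.single 0 1) y := by
    rw [hasDerivAt_pi]
    intro i
    refine Fin.cases ?_ (fun i => ?_) i
    · simpa using! hasDerivAt_id y
    · simpa using! hasDerivAt_const y (0 : ℝ)
  exact (((contDiff_partialD hf w).differentiable (by simp) _).hasFDerivAt).comp_hasDerivAt y h1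

theorem contDiff_axisD (hf : ContDiff ℝ ∞ f) (w : List (Fin (n + 1))) :
    ContDiff ℝ ∞ fun y => axisD f y w :=
  (contDiff_partialD hf w).comp ((consL n).contDiff.comp (contDiff_id.prodMk contDiff_const))

theorem cons_zero_zero : (Fin.cons 0 0 : Space n) = 0 := by
  rw [← consL_apply]
  exact map_zero _

theorem iteratedDeriv_axisD (hf : ContDiff ℝ ∞ f) (k : ℕ) (w : List (Fin (n + 1))) :
    iteratedDeriv k (fun y => axisD f y w) 0 = partialD (List.replicate k 0 ++ w) f 0 := by
  induction k generalizing w with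
  | zero => simp [axisD, cons_zero_zero]
  | succ k ih =>
    rw [iteratedDeriv_succ', funext fun y => (hasDerivAt_axisD hf w y).deriv, ih,
      List.replicate_succ', List.append_assoc, List.singleton_append]

theorem contDiff_zForm {F : ℝ → List (Fin (n + 1)) → ℝ} (hF : ∀ w, ContDiff ℝ ∞ fun y => F y w)
    {r : ℝ → Fin n → ℝ} (hr : ContDiff ℝ ∞ r) (k : ℕ) (w : List (Fin (n + 1))) :
    ContDiff ℝ ∞ fun y => zForm (F y) k w (r y) := by
  induction k generalizing w with
  | zero => exact hF w
  | succ k ih => exact ContDiff.sum fun i _ => (contDiff_pi.1 hr i).mul (ih _)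

theorem hasDerivAt_zForm {F : ℝ → List (Fin (n + 1)) → ℝ} {F' : List (Fin (n + 1)) → ℝ}
    (hF : ∀ w, HasDerivAt (fun y => F y w) (F' w) 0)
    {r : ℝ → Fin n → ℝ} (hr : HasDerivAt r 0 0) (k : ℕ) (w : List (Fin (n + 1))) :
    HasDerivAt (fun y => zForm (F y) k w (r y)) (zForm F' k w (r 0)) 0 := by
  induction k generalizing w with
  | zero => exact hF w
  | succ k ih =>
    refine (HasDerivAt.fun_sum fun i _ => (hasDerivAt_pi.1 hr i).mul (ih (i.succ :: w))).congr_deriv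
      ?_
    simp [zForm]

theorem partialD_neg (hf : ContDiff ℝ ∞ f) (he : ∀ x, f (-x) = f x) (w : List (Fin (n + 1)))
    (x : Space n) : partialD w f (-x) = (-1) ^ w.length * partialD w f x := by
  induction w generalizing x with
  | nil => simp [partialD, he]
  | cons i w ih =>
    have h1 := fderiv_comp_neg_apply (contDiff_partialD hf w) x
    rw [funext ih, fderiv_const_mul ((contDiff_partialD hf w).differentiable (by simp) x)] at h1
    have h2 := congrArg (fun L : Space n →L[ℝ] ℝ => L (Pi.single i 1)) h1
    simp only [smul_apply, neg_apply, smul_eq_mul] at h2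
    simp only [partialD, List.length_cons, pow_succ]
    linarith

theorem partialD_zero_of_odd (hf : ContDiff ℝ ∞ f) (he : ∀ x, f (-x) = f x)
    {w : List (Fin (n + 1))} (hw : Odd w.length) : partialD w f 0 = 0 := by
  have h1 := partialD_neg hf he w 0
  rw [neg_zero, hw.neg_one_pow] at h1
  linarith

theorem partialD_swap (hf : ContDiff ℝ ∞ f) (v : List (Fin (n + 1))) (i j : Fin (n + 1)) :
    partialD (v ++ [i, j]) f = partialD (v ++ [j, i]) f := by
  induction v with
  | nil =>
    funext x
    simp only [List.nil_append]
    rw [partialD_pair hf, partialD_pair hf, sndFDeriv_symm hf]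
  | cons k v ih =>
    funext x
    simp only [List.cons_append, partialD, ih]

theorem iteratedDeriv_pow_mul {A : ℝ → ℝ} (hA : ContDiff ℝ ∞ A) (k N : ℕ) :
    iteratedDeriv N (fun y => y ^ k * A y) 0 = N.descFactorial k * iteratedDeriv (N - k) A 0 := by
  induction k generalizing N with
  | zero => simp
  | succ k ih =>
    have h1 : (fun y => y ^ (k + 1) * A y) = fun y => y * (y ^ k * A y) := funext fun y => by ring
    rw [h1]
    cases N with
    | zero => simp
    | succ N =>
      have h2 : ContDiff ℝ ∞ fun y : ℝ => y ^ k * A y := (contDiff_id.pow k).mul hA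
      rw [iteratedDeriv_succ_id_mul h2, zero_mul, zero_add, ih,
        Nat.succ_descFactorial_succ, Nat.succ_sub_succ]
      push_cast
      ring

theorem iteratedDeriv_eq_zero_of_isBigO {u : ℝ → ℝ} (hu : ContDiff ℝ ∞ u) {N : ℕ}
    (hO : u =O[𝓝 0] fun y => y ^ N) {k : ℕ} (hk : k < N) : iteratedDeriv k u 0 = 0 := by
  induction k using Nat.strong_induction_on with
  | _ k ih =>
    obtain ⟨G, hG, hGe, hG0⟩ := exists_eq_pow_mul hu k fun j hj => ih j hj (hj.trans hk)
    have h1 : Tendsto G (𝓝[≠] 0) (𝓝 (G 0)) :=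
      hG.continuous.continuousAt.tendsto.mono_left nhdsWithin_le_nhds
    have h2 : Tendsto G (𝓝[≠] 0) (𝓝 0) := by
      have h3 : G =O[𝓝[≠] 0] fun y : ℝ => y := by
        have h4 := (isBigO_refl (fun y : ℝ => (y ^ k)⁻¹) (𝓝[≠] 0)).mul
          ((hO.trans (isBigO_pow_of_le (show k + 1 ≤ N from hk))).mono nhdsWithin_le_nhds)
        refine h4.congr' ?_ ?_
        · filter_upwards [self_mem_nhdsWithin] with y hy
          rw [hGe, inv_mul_cancel_left₀ (pow_ne_zero k hy)]
        · filter_upwards [self_mem_nhdsWithin] with y hy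
          rw [pow_succ, inv_mul_cancel_left₀ (pow_ne_zero k hy)]
      exact h3.trans_tendsto (tendsto_id.mono_left nhdsWithin_le_nhds)
    rw [hG0, tendsto_nhds_unique h1 h2, mul_zero]

end Expansion

/-! ### Even invariants of low order -/

section Tables

variable {n : ℕ} {f : Space n → ℝ} {Z : ℝ → Fin n → ℝ}

/-- The critical value is stationary: an approximate solution `ζ` of `f_z(y, ζ(y)) = 0` gives it
with an error of twice the order. -/
theorem IsAdmissible.isBigO_critValue (h : IsAdmissible f Z) {ζ : ℝ → Fin n → ℝ}
    (hζ : Continuous ζ) (hζ0 : ζ 0 = 0) {N : ℕ}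
    (hO : ∀ i : Fin n, (fun y => partialD [i.succ] f (Fin.cons y (ζ y))) =O[𝓝 0] fun y => y ^ N) :
    (fun y => f (Fin.cons y (ζ y)) - alongCurve Z f y) =O[𝓝 0] fun y => y ^ (2 * N) := by
  obtain ⟨B₀, hB⟩ := exists_splitsAt h.smooth h.crit h.ker
  obtain ⟨C, hC⟩ := hB.exists_bound
  have hgrad : (fun y => dz (f ∘ consL n) (y, ζ y)) =O[𝓝 0] fun y => y ^ N := by
    have h1 : ∀ y, dz (f ∘ consL n) (y, ζ y) = ∑ i, partialD [i.succ] f (Fin.cons y (ζ y)) •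
        (ContinuousLinearMap.proj i : (Fin n → ℝ) →L[ℝ] ℝ) := fun y => by
      ext1 v
      rw [clm_apply_eq_sum, sum_apply]
      refine Finset.sum_congr rfl fun i _ => ?_
      rw [dz_comp_consL_single, consL_apply]
      simp [mul_comm]
    simp only [h1]
    refine IsBigO.fun_sum fun i _ => ?_
    refine IsBigO.trans (IsBigO.of_bound
      ‖(ContinuousLinearMap.proj i : (Fin n → ℝ) →L[ℝ] ℝ)‖
      (Eventually.of_forall fun y => ?_)) (hO i)
    rw [norm_smul, mul_comm]
  have hZc := h.curve.smooth.continuous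
  have hδ : (fun y => ζ y - Z y) =O[𝓝 0] fun y => y ^ N := by
    have hc : Continuous fun y : ℝ => (((y, ζ y), (y, Z y)) : (ℝ × (Fin n → ℝ)) × _) := by fun_prop
    have ht := hc.tendsto 0
    rw [hζ0, h.curve.zero] at ht
    refine IsBigO.trans (IsBigO.of_bound C ?_) hgrad
    filter_upwards [ht.eventually hC, h.curve.crit] with y h1 h2
    have h3 := h1 rfl
    rwa [h2, sub_zero] at h3
  have hR : (fun y => remForm (f ∘ consL n) Z (y, ζ y - Z y)) =O[𝓝 0] fun _ => (1 : ℝ) := by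
    have hc : Continuous fun y => remForm (f ∘ consL n) Z (y, ζ y - Z y) :=
      (contDiff_remForm (contDiff_comp_consL h.smooth) h.curve.smooth).continuous.comp
        (by fun_prop : Continuous fun y => (y, ζ y - Z y))
    exact hc.continuousAt.isBigO_one ℝ
  have h1 : (fun y => remForm (f ∘ consL n) Z (y, ζ y - Z y) (ζ y - Z y) (ζ y - Z y)) =O[𝓝 0]
      fun y => y ^ (2 * N) := by
    have h2 := (hR.norm_left.mul hδ.norm_left).mul hδ.norm_left
    have h3 : (fun y : ℝ => 1 * y ^ N * y ^ N) = fun y => y ^ (2 * N) := funext fun y => by ring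
    rw [h3] at h2
    refine IsBigO.trans (IsBigO.of_bound 1 (Eventually.of_forall fun y => ?_)) h2
    rw [one_mul, norm_mul, norm_mul, norm_norm, norm_norm]
    exact ContinuousLinearMap.le_opNorm₂ _ _ _
  refine (h1.const_mul_left (1 / 2)).congr' ?_ EventuallyEq.rfl
  filter_upwards [h.curve.crit] with y hy
  have h2 := eq_add_remForm (contDiff_comp_consL h.smooth) h.curve.smooth y (ζ y - Z y)
  rw [hy, add_sub_cancel] at h2
  change f (Fin.cons y (ζ y)) = alongCurve Z f y + 0 + _ at h2
  rw [h2]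
  ring

theorem iteratedDeriv_zForm_axisD (hf : ContDiff ℝ ∞ f) (k m : ℕ) (w : List (Fin (n + 1)))
    (p : Fin n → ℝ) : iteratedDeriv k (fun y => zForm (axisD f y) m w p) 0 =
      zForm (fun w => partialD (List.replicate k 0 ++ w) f 0) m w p := by
  induction m generalizing w with
  | zero => exact iteratedDeriv_axisD hf k w
  | succ m ih =>
    simp only [zForm]
    rw [iteratedDeriv_sum _ fun i _ => contDiff_const.mul
      (contDiff_zForm (contDiff_axisD hf) contDiff_const m _)]
    refine Finset.sum_congr rfl fun i _ => ?_
    rw [iteratedDeriv_const_mul_field, ih]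

theorem dyzz_symm (hf : ContDiff ℝ ∞ f) (k : ℕ) (i j : Fin n) :
    dyzz f k i j = dyzz f k j i :=
  congrFun (partialD_swap hf (List.replicate k 0) i.succ j.succ) 0

theorem dotProduct_dyzz_comm (hf : ContDiff ℝ ∞ f) (k : ℕ) (v w : Fin n → ℝ) :
    v ⬝ᵥ (dyzz f k).mulVec w = w ⬝ᵥ (dyzz f k).mulVec v := by
  have h1 : (dyzz f k).transpose = dyzz f k := by
    ext i j
    exact dyzz_symm hf k j i
  rw [Matrix.dotProduct_mulVec, ← Matrix.mulVec_transpose, h1, dotProduct_comm]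

theorem zForm_one_nil (k : ℕ) (p : Fin n → ℝ) :
    zForm (fun w => partialD (List.replicate k 0 ++ w) f 0) 1 [] p = p ⬝ᵥ dyz f k := rfl

theorem zForm_one_singleton (hf : ContDiff ℝ ∞ f) (k : ℕ) (l : Fin n) (p : Fin n → ℝ) :
    zForm (fun w => partialD (List.replicate k 0 ++ w) f 0) 1 [l.succ] p =
      (dyzz f k).mulVec p l := by
  change ∑ i, p i * dyzz f k i l = ∑ i, dyzz f k l i * p i
  exact Finset.sum_congr rfl fun i _ => by rw [dyzz_symm hf, mul_comm]

theorem zForm_two_nil (hf : ContDiff ℝ ∞ f) (k : ℕ) (p : Fin n → ℝ) :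
    zForm (fun w => partialD (List.replicate k 0 ++ w) f 0) 2 [] p =
      p ⬝ᵥ (dyzz f k).mulVec p :=
  Finset.sum_congr rfl fun i _ => congrArg (p i * ·) (zForm_one_singleton hf k i p)

theorem zForm_one_add (F : List (Fin (n + 1)) → ℝ) (w : List (Fin (n + 1))) (p q : Fin n → ℝ)
    (s : ℝ) : zForm F 1 w (p + s • q) = zForm F 1 w p + s * zForm F 1 w q := by
  simp only [zForm, Pi.add_apply, Pi.smul_apply, smul_eq_mul, Finset.mul_sum,
    ← Finset.sum_add_distrib]
  exact Finset.sum_congr rfl fun i _ => by ring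

theorem zForm_two_add (F : List (Fin (n + 1)) → ℝ) (w : List (Fin (n + 1))) (p q : Fin n → ℝ)
    (s : ℝ) : zForm F 2 w (p + s • q) = zForm F 2 w p +
      s * (zForm F 2 w (p + q) - zForm F 2 w p - zForm F 2 w q) + s ^ 2 * zForm F 2 w q := by
  have h1 : ∀ v : Fin n → ℝ, zForm F 2 w v = ∑ i, v i * zForm F 1 (i.succ :: w) v := fun _ => rfl
  have h2 : ∀ i : Fin n, zForm F 1 (i.succ :: w) (p + q) =
      zForm F 1 (i.succ :: w) p + zForm F 1 (i.succ :: w) q := fun i => by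
    simpa using zForm_one_add F (i.succ :: w) p q 1
  simp only [h1, h2, zForm_one_add, Finset.mul_sum, ← Finset.sum_sub_distrib,
    ← Finset.sum_add_distrib, Pi.add_apply, Pi.smul_apply, smul_eq_mul]
  exact Finset.sum_congr rfl fun i _ => by ring

theorem contDiff_pow_mul {g : ℝ → ℝ} (hg : ContDiff ℝ ∞ g) (k : ℕ) :
    ContDiff ℝ ∞ fun y : ℝ => y ^ k * g y :=
  (contDiff_id.pow k).mul hg

/-- For `j < 2` the truncated index `j - 2` is harmless, since the descending factorial vanishes. -/
theorem iteratedDeriv_zForm_one (hf : ContDiff ℝ ∞ f) (w : List (Fin (n + 1))) (p q : Fin n → ℝ)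
    (j : ℕ) : iteratedDeriv j (fun y : ℝ => zForm (axisD f y) 1 w (p + y ^ 2 • q)) 0 =
      zForm (fun w => partialD (List.replicate j 0 ++ w) f 0) 1 w p + j.descFactorial 2 *
        zForm (fun w => partialD (List.replicate (j - 2) 0 ++ w) f 0) 1 w q := by
  have hs : ∀ v : Fin n → ℝ, ContDiff ℝ ∞ fun y => zForm (axisD f y) 1 w v := fun v =>
    contDiff_zForm (contDiff_axisD hf) contDiff_const 1 w
  have hle : (j : WithTop ℕ∞) ≤ ∞ := by exact_mod_cast le_top
  simp only [zForm_one_add]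
  rw [iteratedDeriv_fun_add ((hs p).of_le hle).contDiffAt
    ((contDiff_pow_mul (hs q) 2).of_le hle).contDiffAt, iteratedDeriv_pow_mul (hs q),
    iteratedDeriv_zForm_axisD hf, iteratedDeriv_zForm_axisD hf]

theorem iteratedDeriv_zForm_two (hf : ContDiff ℝ ∞ f) (p q : Fin n → ℝ) (j : ℕ) :
    iteratedDeriv j (fun y : ℝ => zForm (axisD f y) 2 [] (p + y ^ 2 • q)) 0 =
      p ⬝ᵥ (dyzz f j).mulVec p + j.descFactorial 2 * (2 * (p ⬝ᵥ (dyzz f (j - 2)).mulVec q)) +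
        j.descFactorial 4 * (q ⬝ᵥ (dyzz f (j - 4)).mulVec q) := by
  have hs : ∀ v : Fin n → ℝ, ContDiff ℝ ∞ fun y => zForm (axisD f y) 2 [] v := fun v =>
    contDiff_zForm (contDiff_axisD hf) contDiff_const 2 []
  have hle : (j : WithTop ℕ∞) ≤ ∞ := by exact_mod_cast le_top
  have hle' : ∀ k : ℕ, (k : WithTop ℕ∞) ≤ ∞ := fun k => by exact_mod_cast le_top
  have hs2 : ContDiff ℝ ∞ fun y => zForm (axisD f y) 2 [] (p + q) - zForm (axisD f y) 2 [] p -
    zForm (axisD f y) 2 [] q := ((hs _).sub (hs _)).sub (hs _)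
  simp only [zForm_two_add, ← pow_mul, Nat.reduceMul]
  rw [iteratedDeriv_fun_add ((((hs p).add (contDiff_pow_mul hs2 2))).of_le hle).contDiffAt
    ((contDiff_pow_mul (hs q) 4).of_le hle).contDiffAt,
    iteratedDeriv_fun_add ((hs p).of_le hle).contDiffAt
    ((contDiff_pow_mul hs2 2).of_le hle).contDiffAt, iteratedDeriv_pow_mul (hs q),
    iteratedDeriv_pow_mul hs2, iteratedDeriv_fun_sub
      ((((hs _).sub (hs _))).of_le (hle' _)).contDiffAt
      ((hs _).of_le (hle' _)).contDiffAt,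
    iteratedDeriv_fun_sub ((hs _).of_le (hle' _)).contDiffAt
      ((hs _).of_le (hle' _)).contDiffAt]
  simp only [iteratedDeriv_zForm_axisD hf, zForm_two_nil hf]
  congr 3
  rw [Matrix.mulVec_add, dotProduct_add, add_dotProduct, add_dotProduct,
    dotProduct_dyzz_comm hf _ q p]
  ring

/-- The vector of the coefficients of `y ^ 5` in the solution of `f_z(y, z) = 0`, for even `f`. -/
noncomputable def tabQ (f : Space n → ℝ) : Fin n → ℝ :=
  (-(1 / 120) : ℝ) • (invHess f).mulVec (dyz f 5) +
    (1 / 12 : ℝ) • (invHess f).mulVec ((dyzz f 2).mulVec (tabU f))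

/-- The vector `z = - u y³ / 6 + q y⁵`, divided by `y³`. -/
noncomputable def tabR (f : Space n → ℝ) (y : ℝ) : Fin n → ℝ :=
  (-(1 / 6) : ℝ) • tabU f + y ^ 2 • tabQ f

theorem contDiff_tabR : ContDiff ℝ ∞ (tabR f) :=
  contDiff_const.add ((contDiff_id.pow 2).smul contDiff_const)

theorem IsAdmissible.dyzz_mulVec_invHess (h : IsAdmissible f Z) (v : Fin n → ℝ) :
    (dyzz f 0).mulVec ((invHess f).mulVec v) = v := by
  rw [Matrix.mulVec_mulVec, invHess,
    Matrix.mul_nonsing_inv _ ((Matrix.isUnit_iff_isUnit_det _).1 h.isUnit_dyzz), Matrix.one_mulVec]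

/-- The Taylor polynomial of degree `< N` in `z`, evaluated at `z = y³ r(y)`. -/
noncomputable def tabTaylor (f : Space n → ℝ) (N : ℕ) (w : List (Fin (n + 1))) (y : ℝ) : ℝ :=
  ∑ k ∈ Finset.range N, zForm (axisD f y) k w (y ^ 3 • tabR f y) / k.factorial

theorem contDiff_tabTaylor (hf : ContDiff ℝ ∞ f) (N : ℕ) (w : List (Fin (n + 1))) :
    ContDiff ℝ ∞ (tabTaylor f N w) :=
  ContDiff.sum fun k _ => (contDiff_zForm (contDiff_axisD hf)
    ((contDiff_id.pow 3).smul contDiff_tabR) k w).div_const _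

theorem isBigO_tabTaylor (hf : ContDiff ℝ ∞ f) (N : ℕ) (w : List (Fin (n + 1))) :
    (fun y => partialD w f (Fin.cons y (y ^ 3 • tabR f y)) - tabTaylor f N w y) =O[𝓝 0]
      fun y => y ^ (3 * N) := by
  obtain ⟨C, hC0, hC⟩ := exists_zForm_bound hf N w
  have hr : (tabR f) =O[𝓝 0] fun _ => (1 : ℝ) :=
    contDiff_tabR.continuous.continuousAt.isBigO_one ℝ
  have hζ : (fun y => y ^ 3 • tabR f y) =O[𝓝 0] fun y => y ^ 3 := by
    simpa using (isBigO_refl (fun y : ℝ => y ^ 3) (𝓝 0)).smul hr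
  have hζc : Continuous fun y : ℝ => y ^ 3 • tabR f y :=
    (continuous_pow 3).smul contDiff_tabR.continuous
  have h1 : ∀ᶠ y in 𝓝 (0 : ℝ), ‖y ^ 3 • tabR f y‖ ≤ 1 := by
    filter_upwards [hζc.norm.continuousAt.eventually_lt continuousAt_const
      (show ‖(0 : ℝ) ^ 3 • tabR f 0‖ < 1 by simp)] with y hy using hy.le
  have h2 : ∀ᶠ y in 𝓝 (0 : ℝ), |y| ≤ 1 :=
    (continuous_abs.continuousAt.eventually_lt continuousAt_const
      (show |(0 : ℝ)| < 1 by simp)).mono fun y hy => hy.le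
  have h3 := hζ.norm_left.pow N
  simp only [← pow_mul] at h3
  refine IsBigO.trans (IsBigO.of_bound C ?_) h3
  filter_upwards [h1, h2] with y hy1 hy2
  rw [norm_pow, norm_norm]
  exact hC y _ hy2 hy1

/-- The curve `z = y³ r(y)` solves `f_z = 0` up to `O(y⁶)`: the coefficients of `1, y², y⁴` vanish
by parity, that of `y` by the condition on the kernel, and those of `y³` and `y⁵` by the choice of
`r`. -/
theorem IsAdmissible.isBigO_grad_tab (h : IsAdmissible f Z) (he : ∀ x, f (-x) = f x) (l : Fin n) :
    (fun y => partialD [l.succ] f (Fin.cons y (y ^ 3 • tabR f y))) =O[𝓝 0] fun y => y ^ 6 := by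
  have hf := h.smooth
  have hT := isBigO_tabTaylor hf 2 [l.succ]
  have hs := contDiff_tabTaylor hf 2 [l.succ]
  have h1 : ∀ j, iteratedDeriv j (tabTaylor f 2 [l.succ]) 0 = dyz f j l + j.descFactorial 3 *
      ((dyzz f (j - 3)).mulVec ((-(1 / 6) : ℝ) • tabU f) l +
        (j - 3).descFactorial 2 * (dyzz f (j - 3 - 2)).mulVec (tabQ f) l) := fun j => by
    have hle : (j : WithTop ℕ∞) ≤ ∞ := by exact_mod_cast le_top
    have h2 : tabTaylor f 2 [l.succ] = fun y => axisD f y [l.succ] +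
        y ^ 3 * zForm (axisD f y) 1 [l.succ] (tabR f y) := funext fun y => by
      simp [tabTaylor, Finset.sum_range_succ, zForm_smul, zForm]
    have h3 : ContDiff ℝ ∞ fun y => zForm (axisD f y) 1 [l.succ] (tabR f y) :=
      contDiff_zForm (contDiff_axisD hf) contDiff_tabR 1 _
    rw [h2, iteratedDeriv_fun_add ((contDiff_axisD hf _).of_le hle).contDiffAt
      ((contDiff_pow_mul h3 3).of_le hle).contDiffAt, iteratedDeriv_pow_mul h3,
      iteratedDeriv_axisD hf]
    simp only [tabR]
    rw [iteratedDeriv_zForm_one hf, zForm_one_singleton hf, zForm_one_singleton hf]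
    rfl
  obtain ⟨G, hG, hGe, -⟩ := exists_eq_pow_mul hs 6 fun j hj => by
    have hodd : ∀ k, Odd (k + 1) → dyz f k l = 0 := fun k hk =>
      partialD_zero_of_odd hf he (by simpa using hk)
    have hodd1 : (dyzz f 1) = 0 := by
      ext i j
      exact partialD_zero_of_odd hf he (by simp; decide)
    have hu : (dyzz f 0).mulVec (tabU f) = dyz f 3 := h.dyzz_mulVec_invHess _
    rw [h1]
    interval_cases j
    · simp [hodd 0 (by decide)]
    · have : dyz f 1 l = 0 := partialD_zero_cons hf h.ker l.succ
      simp [this]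
    · simp [hodd 2 (by decide)]
    · simp only [Nat.reduceSub, Matrix.mulVec_smul, hu, Pi.smul_apply, smul_eq_mul,
        Nat.descFactorial]
      norm_num
      ring
    · simp [hodd 4 (by decide), hodd1, Nat.descFactorial]
    · simp only [Nat.reduceSub, Matrix.mulVec_smul, Matrix.mulVec_add, tabQ,
        h.dyzz_mulVec_invHess, Pi.smul_apply, Pi.add_apply, smul_eq_mul, Nat.descFactorial]
      norm_num
      ring
  have h4 : tabTaylor f 2 [l.succ] =O[𝓝 0] fun y => y ^ 6 := by
    have h5 := (isBigO_refl (fun y : ℝ => y ^ 6) (𝓝 0)).mul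
      ((hG.continuous.continuousAt (x := 0)).isBigO_one ℝ)
    simp only [mul_one] at h5
    exact h5.congr_left fun y => (hGe y).symm
  simpa using hT.add h4

/-- The error in the critical value is of order `12`, both from the approximate curve and from the
Taylor expansion of degree `3` in `z = O(y³)`. -/
theorem IsAdmissible.iteratedDeriv_critValue (h : IsAdmissible f Z) (he : ∀ x, f (-x) = f x)
    {N : ℕ} (hN : N < 12) :
    iteratedDeriv N (alongCurve Z f) 0 = iteratedDeriv N (tabTaylor f 4 []) 0 := by
  have hf := h.smooth
  have hζc : Continuous fun y : ℝ => y ^ 3 • tabR f y :=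
    (continuous_pow 3).smul contDiff_tabR.continuous
  have h1 := h.isBigO_critValue hζc (by simp) (h.isBigO_grad_tab he)
  have h2 := (isBigO_tabTaylor hf 4 []).sub h1
  have hs1 := h.contDiff_alongCurve hf
  have hs2 := contDiff_tabTaylor hf 4 []
  have h3 : (fun y => alongCurve Z f y - tabTaylor f 4 [] y) =O[𝓝 0] fun y => y ^ 12 :=
    h2.congr_left fun y => by
      simp only [partialD]
      ring
  have h4 := iteratedDeriv_eq_zero_of_isBigO (hs1.sub hs2) h3 hN
  have hle : (N : WithTop ℕ∞) ≤ ∞ := by exact_mod_cast le_top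
  rw [iteratedDeriv_fun_sub (hs1.of_le hle).contDiffAt (hs2.of_le hle).contDiffAt] at h4
  exact sub_eq_zero.1 h4

/-- The truncated indices on the right occur only with vanishing descending factorials. -/
theorem iteratedDeriv_tabTaylor (hf : ContDiff ℝ ∞ f) (N : ℕ) :
    iteratedDeriv N (tabTaylor f 4 []) 0 = dy f N +
      N.descFactorial 3 * (((-(1 / 6) : ℝ) • tabU f) ⬝ᵥ dyz f (N - 3) +
        (N - 3).descFactorial 2 * (tabQ f ⬝ᵥ dyz f (N - 3 - 2))) +
      1 / 2 * (N.descFactorial 6 *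
        (((-(1 / 6) : ℝ) • tabU f) ⬝ᵥ (dyzz f (N - 6)).mulVec ((-(1 / 6) : ℝ) • tabU f) +
        (N - 6).descFactorial 2 *
          (2 * (((-(1 / 6) : ℝ) • tabU f) ⬝ᵥ (dyzz f (N - 6 - 2)).mulVec (tabQ f))) +
        (N - 6).descFactorial 4 * (tabQ f ⬝ᵥ (dyzz f (N - 6 - 4)).mulVec (tabQ f)))) +
      1 / 6 * (N.descFactorial 9 *
        iteratedDeriv (N - 9) (fun y => zForm (axisD f y) 3 [] (tabR f y)) 0) := by
  have hle : (N : WithTop ℕ∞) ≤ ∞ := by exact_mod_cast le_top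
  have hW : ∀ k, ContDiff ℝ ∞ fun y => zForm (axisD f y) k [] (tabR f y) := fun k =>
    contDiff_zForm (contDiff_axisD hf) contDiff_tabR k _
  have hp : ∀ j k, ContDiff ℝ ∞ fun y : ℝ => y ^ j * zForm (axisD f y) k [] (tabR f y) :=
    fun j k => contDiff_pow_mul (hW k) j
  have h2 : tabTaylor f 4 [] = fun y => ((axisD f y [] +
        y ^ 3 * zForm (axisD f y) 1 [] (tabR f y)) +
        1 / 2 * (y ^ 6 * zForm (axisD f y) 2 [] (tabR f y))) +
        1 / 6 * (y ^ 9 * zForm (axisD f y) 3 [] (tabR f y)) := funext fun y => by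
    simp only [tabTaylor, Finset.sum_range_succ, zForm_smul, Finset.sum_range_zero, zForm]
    norm_num [Nat.factorial]
    ring
  have hc0 : ContDiff ℝ ∞ fun y => axisD f y [] := contDiff_axisD hf _
  have hc1 := hc0.add (hp 3 1)
  have hc2 : ContDiff ℝ ∞ fun y : ℝ => 1 / 2 * (y ^ 6 * zForm (axisD f y) 2 [] (tabR f y)) :=
    contDiff_const.mul (hp 6 2)
  have hc3 : ContDiff ℝ ∞ fun y : ℝ => 1 / 6 * (y ^ 9 * zForm (axisD f y) 3 [] (tabR f y)) :=
    contDiff_const.mul (hp 9 3)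
  rw [h2, iteratedDeriv_fun_add ((hc1.add hc2).of_le hle).contDiffAt (hc3.of_le hle).contDiffAt,
    iteratedDeriv_fun_add (hc1.of_le hle).contDiffAt (hc2.of_le hle).contDiffAt,
    iteratedDeriv_fun_add (hc0.of_le hle).contDiffAt ((hp 3 1).of_le hle).contDiffAt,
    iteratedDeriv_const_mul_field, iteratedDeriv_const_mul_field, iteratedDeriv_pow_mul (hW 1),
    iteratedDeriv_pow_mul (hW 2), iteratedDeriv_pow_mul (hW 3), iteratedDeriv_axisD hf,
    List.append_nil]
  simp only [tabR]
  rw [iteratedDeriv_zForm_one hf, iteratedDeriv_zForm_two hf, zForm_one_nil, zForm_one_nil]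
  rfl

theorem zForm_three_deriv (hf : ContDiff ℝ ∞ f) :
    iteratedDeriv 1 (fun y => zForm (axisD f y) 3 [] (tabR f y)) 0 =
      -(1 / 216) * ∑ i, ∑ j, ∑ l, dyzzz f 1 i j l * tabU f i * tabU f j * tabU f l := by
  have hr : HasDerivAt (tabR f) 0 0 := by
    have h1 := ((hasDerivAt_pow 2 (0 : ℝ)).smul_const (tabQ f)).const_add
      ((-(1 / 6) : ℝ) • tabU f)
    exact h1.congr_deriv (by simp)
  have h2 := hasDerivAt_zForm (fun w => hasDerivAt_axisD hf w 0) hr 3 []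
  rw [iteratedDeriv_one, h2.deriv]
  have h3 : tabR f 0 = (-(1 / 6) : ℝ) • tabU f := by simp [tabR]
  rw [h3, zForm_smul]
  have h4 : zForm (fun w => axisD f 0 (0 :: w)) 3 [] (tabU f) =
      ∑ i, tabU f i * ∑ j, tabU f j * ∑ l, tabU f l * dyzzz f 1 l j i := by
    simp only [zForm, axisD, cons_zero_zero]
    rfl
  rw [h4]
  have h5 : ∑ i, tabU f i * ∑ j, tabU f j * ∑ l, tabU f l * dyzzz f 1 l j i =
      ∑ i, ∑ j, ∑ l, dyzzz f 1 i j l * tabU f i * tabU f j * tabU f l := by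
    simp only [Finset.mul_sum]
    rw [Finset.sum_comm]
    rw [Finset.sum_congr rfl fun j _ => Finset.sum_comm]
    rw [Finset.sum_comm]
    refine Finset.sum_congr rfl fun l _ => Finset.sum_congr rfl fun j _ =>
      Finset.sum_congr rfl fun i _ => ?_
    ring
  rw [h5]
  norm_num

theorem IsAdmissible.critSeq_three (h : IsAdmissible f Z) (he : ∀ x, f (-x) = f x) :
    critSeq f Z 3 = tab2 f := by
  have h1 : dyz f 1 = 0 := funext fun l => partialD_zero_cons h.smooth h.ker l.succ
  rw [critSeq, h.iteratedDeriv_critValue he (by norm_num), iteratedDeriv_tabTaylor h.smooth]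
  simp [Nat.descFactorial, h1, tab2]

theorem IsAdmissible.critSeq_five (h : IsAdmissible f Z) (he : ∀ x, f (-x) = f x) :
    critSeq f Z 5 = tab3 f := by
  have h1 : dyz f 1 = 0 := funext fun l => partialD_zero_cons h.smooth h.ker l.succ
  have hu : (dyzz f 0).mulVec (tabU f) = dyz f 3 := h.dyzz_mulVec_invHess _
  rw [critSeq, h.iteratedDeriv_critValue he (by norm_num), iteratedDeriv_tabTaylor h.smooth, tab3]
  simp only [Nat.reduceSub, Nat.reduceAdd, Matrix.mulVec_smul, hu, h1, dotProduct_smul,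
    smul_dotProduct, smul_eq_mul, Nat.descFactorial, dotProduct_zero]
  norm_num
  ring

theorem IsAdmissible.critSeq_seven (h : IsAdmissible f Z) (he : ∀ x, f (-x) = f x) :
    critSeq f Z 7 = tab4 f := by
  have hf := h.smooth
  have hu : (dyzz f 0).mulVec (tabU f) = dyz f 3 := h.dyzz_mulVec_invHess _
  have hc := dotProduct_dyzz_comm hf 0 ((invHess f).mulVec (dyz f 5)) (tabU f)
  have hd := dotProduct_dyzz_comm hf 0
    ((invHess f).mulVec ((dyzz f 2).mulVec (tabU f))) (tabU f)
  rw [hu, h.dyzz_mulVec_invHess] at hc hd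
  rw [critSeq, h.iteratedDeriv_critValue he (by norm_num), iteratedDeriv_tabTaylor hf, tab4]
  simp only [Nat.reduceSub, Nat.reduceAdd, tabQ, Matrix.mulVec_smul, Matrix.mulVec_add,
    h.dyzz_mulVec_invHess, hc, hd, dotProduct_smul, smul_dotProduct, dotProduct_add,
    add_dotProduct, dotProduct_sub, smul_eq_mul, Nat.descFactorial]
  norm_num
  ring

theorem IsAdmissible.critSeq_nine (h : IsAdmissible f Z) (he : ∀ x, f (-x) = f x) :
    critSeq f Z 9 = tab5 f := by
  have hf := h.smooth
  have hc := dotProduct_dyzz_comm hf 2 (tabU f) ((invHess f).mulVec (dyz f 5))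
  have hd := dotProduct_dyzz_comm hf 2 (tabU f)
    ((invHess f).mulVec ((dyzz f 2).mulVec (tabU f)))
  have hcd := dotProduct_dyzz_comm hf 0 ((invHess f).mulVec ((dyzz f 2).mulVec (tabU f)))
    ((invHess f).mulVec (dyz f 5))
  rw [h.dyzz_mulVec_invHess, h.dyzz_mulVec_invHess] at hcd
  rw [critSeq, h.iteratedDeriv_critValue he (by norm_num), iteratedDeriv_tabTaylor hf, tab5]
  rw [show 9 + 1 - 9 = 1 from rfl, zForm_three_deriv hf]
  simp only [Nat.reduceSub, Nat.reduceAdd, tabQ, Matrix.mulVec_smul, Matrix.mulVec_add,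
    h.dyzz_mulVec_invHess, dotProduct_smul, smul_dotProduct, dotProduct_add,
    add_dotProduct, dotProduct_sub, smul_eq_mul, Nat.descFactorial, hc, hd, hcd]
  norm_num
  ring

end Tables

/-! ### Global representatives of germs -/

section Germs

variable {n : ℕ} {f g : Space n → ℝ}

theorem partialD_congr (h : f =ᶠ[𝓝 0] g) (w : List (Fin (n + 1))) :
    partialD w f =ᶠ[𝓝 0] partialD w g := by
  induction w with
  | nil => exact h
  | cons i w ih =>
    exact ih.fderiv.mono fun x hx =>
      congrArg (fun L : Space n →L[ℝ] ℝ => L (Pi.single i 1)) hx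

theorem partialD_congr_zero (h : f =ᶠ[𝓝 0] g) (w : List (Fin (n + 1))) :
    partialD w f 0 = partialD w g 0 :=
  (partialD_congr h w).eq_of_nhds

theorem dy_congr (h : f =ᶠ[𝓝 0] g) : dy f = dy g :=
  funext fun _ => partialD_congr_zero h _

theorem dyz_congr (h : f =ᶠ[𝓝 0] g) : dyz f = dyz g :=
  funext fun _ => funext fun _ => partialD_congr_zero h _

theorem dyzz_congr (h : f =ᶠ[𝓝 0] g) : dyzz f = dyzz g :=
  funext fun _ => Matrix.ext fun _ _ => partialD_congr_zero h _

theorem dyzzz_congr (h : f =ᶠ[𝓝 0] g) : dyzzz f = dyzzz g :=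
  funext fun _ => funext fun _ => funext fun _ => funext fun _ => partialD_congr_zero h _

theorem invHess_congr (h : f =ᶠ[𝓝 0] g) : invHess f = invHess g := by
  rw [invHess, invHess, dyzz_congr h]

theorem aNum_congr (h : f =ᶠ[𝓝 0] g) (P : ℕ → MvPolynomial (JetVar n) ℤ) :
    aNum P f = aNum P g := by
  have h1 : JetVar.value f = JetVar.value g := by
    funext x
    cases x with
    | deriv w => exact partialD_congr_zero h w
    | inv i j => exact congrFun (congrFun (invHess_congr h) i) j
  funext m
  rw [aNum, aNum, dy_congr h, h1]

theorem aeNum_congr (h : f =ᶠ[𝓝 0] g) (P : ℕ → MvPolynomial (JetVar n) ℤ) :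
    aeNum P f = aeNum P g := by
  funext μ
  rw [aeNum, aeNum, aNum_congr h]

theorem tabU_congr (h : f =ᶠ[𝓝 0] g) : tabU f = tabU g := by
  rw [tabU, tabU, invHess_congr h, dyz_congr h]

theorem HessianKernelIsAxis.congr (h : f =ᶠ[𝓝 0] g) (hf : HessianKernelIsAxis f) :
    HessianKernelIsAxis g := by
  rw [HessianKernelIsAxis, ← h.fderiv.fderiv_eq]
  exact hf

theorem IsDiffeoGerm.eventually_symm_eq {k : OpenPartialHomeomorph (Space n) (Space n)}
    (hk : IsDiffeoGerm k) (h : f =ᶠ[𝓝 0] g) :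
    ∀ᶠ y in 𝓝 (0 : Space n), f (k.symm y) = g (k.symm y) :=
  hk.symm.tendsto.eventually h

theorem ReducesTo.congr (h : f =ᶠ[𝓝 0] g) {b : ℝ} {d : ℕ} (hf : ReducesTo f b d) :
    ReducesTo g b d := by
  obtain ⟨c, Q, hQ, k, hk, hfk⟩ := hf
  refine ⟨c, Q, hQ, k, hk, ?_⟩
  filter_upwards [hk.eventually_symm_eq h, hfk] with y h1 h2 using h1.symm.trans h2

theorem ReducesOddlyTo.congr (h : f =ᶠ[𝓝 0] g) {b : ℝ} {d : ℕ} (hf : ReducesOddlyTo f b d) :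
    ReducesOddlyTo g b d := by
  obtain ⟨c, Q, hQ, k, hk, ho, hfk⟩ := hf
  refine ⟨c, Q, hQ, k, hk, ho, ?_⟩
  filter_upwards [hk.eventually_symm_eq h, hfk] with y h1 h2 using h1.symm.trans h2

theorem ReducesOddlyTo.reducesTo {b : ℝ} {d : ℕ} (hf : ReducesOddlyTo f b d) :
    ReducesTo f b d := by
  obtain ⟨c, Q, hQ, k, hk, -, hfk⟩ := hf
  exact ⟨c, Q, hQ, k, hk, hfk⟩

theorem SmoothNearZero.eventually_contDiffAt (hf : SmoothNearZero f) :
    ∀ᶠ x in 𝓝 (0 : Space n), ContDiffAt ℝ ∞ f x := by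
  obtain ⟨U, hU, h0, hs⟩ := hf
  filter_upwards [hU.mem_nhds h0] with x hx using hs.contDiffAt (hU.mem_nhds hx)

/-- The germ of `f` has an admissible global representative. -/
theorem SmoothNearZero.exists_isAdmissible (hf : SmoothNearZero f) (h0 : fderiv ℝ f 0 = 0)
    (hk : HessianKernelIsAxis f) : ∃ g Z, g =ᶠ[𝓝 0] f ∧ IsAdmissible g Z := by
  obtain ⟨g, hg, hgf, -⟩ := exists_contDiff_eventuallyEq hf.eventually_contDiffAt
  obtain ⟨Z, hZ⟩ := EvenSing.exists_isAdmissible hg (hgf.fderiv_eq.trans h0) (hk.congr hgf.symm)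
  exact ⟨g, Z, hgf, hZ⟩

/-- An even germ has an even admissible global representative. -/
theorem SmoothNearZero.exists_isAdmissible_even (hf : SmoothNearZero f) (he : EvenNearZero f)
    (hk : HessianKernelIsAxis f) :
    ∃ g Z, g =ᶠ[𝓝 0] f ∧ (∀ x, g (-x) = g x) ∧ IsAdmissible g Z := by
  obtain ⟨g, hg, hgf, hge⟩ := exists_contDiff_eventuallyEq hf.eventually_contDiffAt
  have hge := hge he
  have h0 : fderiv ℝ g 0 = 0 := by
    have h1 := fderiv_comp_neg_apply hg 0
    rw [neg_zero, funext hge] at h1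
    ext v
    have h2 := DFunLike.congr_fun h1 v
    simp only [neg_apply, zero_apply] at h2 ⊢
    linarith
  obtain ⟨Z, hZ⟩ := EvenSing.exists_isAdmissible hg h0 (hk.congr hgf.symm)
  exact ⟨g, Z, hgf, hge, hZ⟩

end Germs

/-! ### Detection of the types -/

section Types

variable {n : ℕ} {f : Space n → ℝ} {Z : ℝ → Fin n → ℝ}

theorem FirstNonzeroAt.congr {s t : ℕ → ℝ} {m : ℕ} (hm : 2 ≤ m) (h : FirstNonzeroAt s m)
    (hst : ∀ j, 2 ≤ j → t j = s j) : FirstNonzeroAt t m :=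
  ⟨fun j hj hjm => (hst j hj).trans (h.1 j hj hjm), by rw [hst m hm]; exact h.2⟩

theorem IsAdmissible.critSeq_of_even (h : IsAdmissible f Z) (he : ∀ x, f (-x) = f x) {m : ℕ}
    (hm : Even m) : critSeq f Z m = 0 := by
  have h1 := Filter.EventuallyEq.iteratedDeriv_eq (m + 1) (h.alongCurve_neg he)
  rw [iteratedDeriv_comp_neg, neg_zero, hm.add_one.neg_one_pow, neg_one_smul] at h1
  exact self_eq_neg.1 h1.symm

/-- For even `f` only the odd indices `2 μ - 1` matter. -/
theorem IsAdmissible.firstNonzeroAt_iff (h : IsAdmissible f Z) (he : ∀ x, f (-x) = f x) {μ : ℕ}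
    (hμ : 2 ≤ μ) : FirstNonzeroAt (critSeq f Z) (2 * μ - 1) ↔
      FirstNonzeroAt (fun j => critSeq f Z (2 * j - 1)) μ := by
  refine ⟨fun h1 => ⟨fun j hj hjm => h1.1 _ (by omega) (by omega), h1.2⟩,
    fun h1 => ⟨fun j hj hjm => ?_, h1.2⟩⟩
  rcases Nat.even_or_odd' j with ⟨i, rfl | rfl⟩
  · exact h.critSeq_of_even he (even_two_mul i)
  · exact h1.1 (i + 1) (by omega) (by omega)

theorem determinesTypeA {P : ℕ → MvPolynomial (JetVar n) ℤ}
    (hP : ∀ m, 2 ≤ m → (∀ x ∈ (P m).vars, x.Allowed m) ∧ MvPolynomial.constantCoeff (P m) = 0 ∧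
      ∀ f Z, IsAdmissible f Z → aNum P f m = critSeq f Z m) : DeterminesTypeA n P := by
  have hred : ∀ f : Space n → ℝ, SmoothNearZero f → fderiv ℝ f 0 = 0 → HessianKernelIsAxis f →
      ∀ m, 2 ≤ m → FirstNonzeroAt (aNum P f) m → ∀ b, 0 < aNum P f m / b →
        ReducesTo f b (m + 1) := by
    intro f hf h0 hk m hm h1 b hb
    obtain ⟨g, Z, hgf, hg⟩ := hf.exists_isAdmissible h0 hk
    rw [← aNum_congr hgf] at h1 hb
    have h2 : FirstNonzeroAt (critSeq g Z) m :=
      h1.congr hm fun j hj => ((hP j hj).2.2 g Z hg).symm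
    rw [(hP m hm).2.2 g Z hg] at hb
    exact (hg.reducesTo h2.1 hb).congr hgf
  refine ⟨fun m hm => (hP m hm).1, fun m hm => (hP m hm).2.1, fun f hf h0 hk m hm => ⟨?_, ?_⟩,
    fun f hf h0 hk m hm h1 => ⟨?_, fun h2 => ?_, fun h2 => ?_⟩⟩
  · intro h1
    obtain ⟨b, hb, h2⟩ : ∃ b : ℝ, b ≠ 0 ∧ ReducesTo f b (m + 1) := by
      rcases h1 with h1 | h1
      exacts [⟨1, one_ne_zero, h1⟩, ⟨-1, by norm_num, h1⟩]
    obtain ⟨g, Z, hgf, hg⟩ := hf.exists_isAdmissible h0 hk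
    rw [← aNum_congr hgf]
    exact (hg.firstNonzeroAt_of_reducesTo hm hb (h2.congr hgf.symm)).congr hm
      fun j hj => (hP j hj).2.2 g Z hg
  · intro h1
    rcases lt_or_gt_of_ne h1.2 with h2 | h2
    · exact Or.inr (hred f hf h0 hk m hm h1 _ (div_pos_of_neg_of_neg h2 (by norm_num)))
    · exact Or.inl (hred f hf h0 hk m hm h1 _ (div_pos h2 one_pos))
  · exact hred f hf h0 hk m hm h1 _ (by rw [div_self h1.2]; exact one_pos)
  · exact hred f hf h0 hk m hm h1 _ (div_pos h2 one_pos)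
  · exact hred f hf h0 hk m hm h1 _ (div_pos_of_neg_of_neg h2 (by norm_num))

end Types

end EvenSing

theorem mainTheorem4 (n : ℕ) :
    ∃ P : ℕ → MvPolynomial (EvenSing.JetVar n) ℤ,
      EvenSing.DeterminesTypeA n P ∧
      ∀ f : EvenSing.Space n → ℝ, EvenSing.SmoothNearZero f → EvenSing.EvenNearZero f →
        EvenSing.HessianKernelIsAxis f →
        (EvenSing.aeNum P f 2 = EvenSing.tab2 f ∧ EvenSing.aeNum P f 3 = EvenSing.tab3 f ∧
          EvenSing.aeNum P f 4 = EvenSing.tab4 f ∧ EvenSing.aeNum P f 5 = EvenSing.tab5 f) ∧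
        ∀ μ : ℕ, 2 ≤ μ →
          (EvenSing.IsAe μ f ↔ EvenSing.FirstNonzeroAt (EvenSing.aeNum P f) μ) ∧
          (EvenSing.FirstNonzeroAt (EvenSing.aeNum P f) μ →
            EvenSing.ReducesOddlyTo f (EvenSing.aeNum P f μ) (2 * μ) ∧
            (0 < EvenSing.aeNum P f μ → EvenSing.IsAePlus μ f) ∧
            (EvenSing.aeNum P f μ < 0 → EvenSing.IsAeMinus μ f)) := by
  open EvenSing in
  obtain ⟨P, hP⟩ := exists_correction n
  refine ⟨P, determinesTypeA hP, fun f hf he hk => ?_⟩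
  obtain ⟨g, Z, hgf, hge, hg⟩ := hf.exists_isAdmissible_even he hk
  have hnum : ∀ μ, 2 ≤ μ → aeNum P f μ = critSeq g Z (2 * μ - 1) := fun μ hμ => by
    rw [← aeNum_congr hgf, aeNum, (hP _ (by omega)).2.2 g Z hg]
  have htab : tab2 g = tab2 f ∧ tab3 g = tab3 f ∧ tab4 g = tab4 f ∧ tab5 g = tab5 f := by
    simp only [tab2, tab3, tab4, tab5, dy_congr hgf, dyz_congr hgf, dyzz_congr hgf,
      dyzzz_congr hgf, tabU_congr hgf, invHess_congr hgf, and_self]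
  refine ⟨⟨?_, ?_, ?_, ?_⟩, fun μ hμ => ?_⟩
  · rw [hnum 2 le_rfl, ← htab.1, ← hg.critSeq_three hge]
  · rw [hnum 3 (by norm_num), ← htab.2.1, ← hg.critSeq_five hge]
  · rw [hnum 4 (by norm_num), ← htab.2.2.1, ← hg.critSeq_seven hge]
  · rw [hnum 5 (by norm_num), ← htab.2.2.2, ← hg.critSeq_nine hge]
  have hdeg : 2 * μ - 1 + 1 = 2 * μ := by omega
  have hred : FirstNonzeroAt (aeNum P f) μ → ∀ b, 0 < aeNum P f μ / b →
      ReducesOddlyTo f b (2 * μ) := by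
    intro h1 b hb
    have h2 := (hg.firstNonzeroAt_iff hge hμ).2 (h1.congr hμ fun j hj => (hnum j hj).symm)
    rw [hnum μ hμ] at hb
    have h3 := (hg.reducesOddlyTo hge (by rw [hdeg]; exact even_two_mul μ) h2.1 hb).congr hgf
    rwa [hdeg] at h3
  refine ⟨⟨fun h1 => ?_, fun h1 => ?_⟩, fun h1 => ⟨?_, fun h2 => ?_, fun h2 => ?_⟩⟩
  · obtain ⟨b, hb, h2⟩ : ∃ b : ℝ, b ≠ 0 ∧ ReducesOddlyTo f b (2 * μ) := by
      rcases h1 with h1 | h1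
      exacts [⟨1, one_ne_zero, h1⟩, ⟨-1, by norm_num, h1⟩]
    have h3 := h2.reducesTo.congr hgf.symm
    rw [← hdeg] at h3
    exact ((hg.firstNonzeroAt_iff hge hμ).1
      (hg.firstNonzeroAt_of_reducesTo (by omega) hb h3)).congr hμ hnum
  · rcases lt_or_gt_of_ne h1.2 with h2 | h2
    · exact Or.inr (hred h1 _ (div_pos_of_neg_of_neg h2 (by norm_num)))
    · exact Or.inl (hred h1 _ (div_pos h2 one_pos))
  · exact hred h1 _ (by rw [div_self h1.2]; exact one_pos)
  · exact hred h1 _ (div_pos h2 one_pos)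
  · exact hred h1 _ (div_pos_of_neg_of_neg h2 (by norm_num))
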